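/- Let $\rho\in\mathbb{C}^{n\times n}$ be a density operator (positive semidefinite, trace one), with von Neumann entropy $H(\rho)=-\mathrm{Tr}[\rho\log\rho]$, where $\log$ is the natural logarithm and $0\log 0=0$. A unitary $U_\rho$ on $A\otimes B=\mathbb{C}^k\otimes\mathbb{C}^n$, for any $k\ge 1$, is a purified query oracle for $\rho$ if $|\psi_\rho\rangle=U_\rho|0\rangle_A|0\rangle_B$ satisfies $\mathrm{Tr}_A(|\psi_\rho\rangle\langle\psi_\rho|)=\rho$. A quantum query algorithm starts in a fixed computational basis state of $A\otimes B\otimes\mathbb{C}^w$ for some finite $w\ge 1$, alternates fixed unitaries (independent of the oracle) with calls to $U_\rho\otimes I$ or $U_\rho^\dagger\otimes I$, and at the end measures in the computational basis and outputs a real number determined by the outcome. Theorem. There are constants $C$ and $c$ such that for all $n\ge 1$, $k\ge 1$ and $0<\epsilon<1$ there is a quantum query algorithm making at most $$C\,\frac{n}{\epsilon^{1.5}}\Bigl(1+\log\frac{n}{\epsilon^{1.5}}\Bigr)^{c}=\tilde{\mathcal O}\Bigl(\frac{n}{\epsilon^{1.5}}\Bigr)$$ calls to $U_\rho$ and $U_\rho^\dagger$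 in total which, for every density operator $\rho\in\mathbb{C}^{n\times n}$ and every purified query oracle $U_\rho$ for $\rho$ on $\mathbb{C}^k\otimes\mathbb{C}^n$, outputs with probability at least $2/3$ a number $\tilde H$ with $|\tilde H-H(\rho)|\le\epsilon$. -/

import Mathlib

open scoped Kronecker ComplexOrder

noncomputable section

/-- A density operator `ρ ∈ ℂ^{n×n}`: positive semidefinite with trace one. -/
def IsDensityOperator {n : ℕ} (ρ : Matrix (Fin n) (Fin n) ℂ) : Prop :=
  ρ.PosSemidef ∧ ρ.trace = 1

/-- The von Neumann entropy `H(ρ) = -Tr[ρ log ρ]` (natural logarithm). The operator `log ρ` is given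
by the continuous functional calculus on Hermitian matrices; as `Real.log 0 = 0`, this uses the
convention `0 log 0 = 0`. -/
def vonNeumannEntropy {n : ℕ} (ρ : Matrix (Fin n) (Fin n) ℂ) : ℝ :=
  -((ρ * cfc Real.log ρ).trace).re

/-- The rank-one operator `|ψ⟩⟨ψ|`. -/
def ketBra {ι : Type*} (ψ : ι → ℂ) : Matrix ι ι ℂ :=
  Matrix.vecMulVec ψ (star ψ)

/-- The partial trace over the first tensor factor `A = ℂ^k` of an operator on `A ⊗ B`. -/
def partialTraceA {k n : ℕ} (M : Matrix (Fin k × Fin n) (Fin k × Fin n) ℂ) :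
    Matrix (Fin n) (Fin n) ℂ :=
  Matrix.of fun i j => ∑ a, M (a, i) (a, j)

/-- `U` is a purified query oracle for `ρ`: a unitary on `A ⊗ B = ℂ^k ⊗ ℂ^n` such that the state
`|ψ_ρ⟩ = U |0⟩_A |0⟩_B` satisfies `Tr_A |ψ_ρ⟩⟨ψ_ρ| = ρ`. A Schmidt decomposition
`|ψ_ρ⟩ = ∑ i, √(p i) |φ i⟩ |ψ i⟩` of this vector always exists, so it is not asked for separately. -/
def IsPurifiedOracle {k n : ℕ} [NeZero k] [NeZero n]
    (U : Matrix.unitaryGroup (Fin k × Fin n) ℂ) (ρ : Matrix (Fin n) (Fin n) ℂ) : Prop :=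
  partialTraceA (ketBra ((U : Matrix (Fin k × Fin n) (Fin k × Fin n) ℂ).mulVec
    (Pi.single (0, 0) 1))) = ρ

/-- A quantum query algorithm with access to an unknown unitary `U` on `ℂ^k ⊗ ℂ^n` and to its
inverse. It acts on `(ℂ^k ⊗ ℂ^n) ⊗ ℂ^work`, starts in the state `|0⟩|0⟩|0⟩`, and alternates
oracle-independent unitaries with calls to `U ⊗ I` or `U† ⊗ I`. At the end it measures in the
computational basis and outputs a real number depending on the measurement outcome. -/
structure QueryAlgorithm (k n : ℕ) where
  /-- The dimension of the workspace. -/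
  work : ℕ
  /-- The workspace has a basis state `|0⟩`. -/
  work_ne_zero : NeZero work
  /-- The total number of calls to `U` and `U†`. -/
  queries : ℕ
  /-- The unitary applied before the first call is `gate 0`; the one applied right after the call
  number `t` (counting from `0`) is `gate (t + 1)`. Only `gate 0, …, gate queries` are used. -/
  gate : ℕ → Matrix.unitaryGroup ((Fin k × Fin n) × Fin work) ℂ
  /-- Whether the call number `t` is to `U†` (`true`) or to `U` (`false`). -/
  inverse : ℕ → Bool
  /-- The number that is output upon each measurement outcome. -/
  output : (Fin k × Fin n) × Fin work → ℝ

namespace QueryAlgorithm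

variable {k n : ℕ}

/-- The operator `U ⊗ I` or `U† ⊗ I` that the call number `t` applies. -/
def call (𝒜 : QueryAlgorithm k n) (U : Matrix.unitaryGroup (Fin k × Fin n) ℂ) (t : ℕ) :
    Matrix ((Fin k × Fin n) × Fin 𝒜.work) ((Fin k × Fin n) × Fin 𝒜.work) ℂ :=
  ((if 𝒜.inverse t then U⁻¹ else U : Matrix.unitaryGroup (Fin k × Fin n) ℂ) :
    Matrix (Fin k × Fin n) (Fin k × Fin n) ℂ) ⊗ₖ (1 : Matrix (Fin 𝒜.work) (Fin 𝒜.work) ℂ)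

/-- The state of the algorithm after `t` calls and the unitary `gate t` that follows them. -/
def state [NeZero k] [NeZero n] (𝒜 : QueryAlgorithm k n)
    (U : Matrix.unitaryGroup (Fin k × Fin n) ℂ) : ℕ → ((Fin k × Fin n) × Fin 𝒜.work → ℂ)
  | 0 =>
    haveI := 𝒜.work_ne_zero
    (𝒜.gate 0).1.mulVec (Pi.single ((0, 0), 0) 1)
  | t + 1 => (𝒜.gate (t + 1)).1.mulVec ((𝒜.call U t).mulVec (𝒜.state U t))

open Classical in
/-- The probability, by the Born rule, that on the oracle `U` the output lies in `S`. -/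
def outputProb [NeZero k] [NeZero n] (𝒜 : QueryAlgorithm k n)
    (U : Matrix.unitaryGroup (Fin k × Fin n) ℂ) (S : Set ℝ) : ℝ :=
  ∑ x, if 𝒜.output x ∈ S then ‖𝒜.state U 𝒜.queries x‖ ^ 2 else 0

end QueryAlgorithm

end

/-! Let `ψ = U|0⟩|0⟩` have coefficient matrix `M`, so that `Mᴴ M = ρᵀ`, and let `Φ` be the maximally
entangled state of two further copies of `ℂⁿ`. Let `R` be the reflection about the range of `u ↦ u ⊗
Φ`, and `S` minus the reflection about the range of `w ↦ ψ ⊗ w`, where this `ψ` occupies `A` and the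
first extra copy. Compressed to the range of `u ↦ u ⊗ Φ`, `S` sends the vector with coefficients `M
Z` to the one with coefficients `M (1 - (2/n) ρᵀ) Z`. Powers of a product of two reflections obey
the Chebyshev recurrence (`walk_recurrence`), so with `ξ = ψ ⊗ Φ` one gets `⟨ξ|R (S R)^t|ξ⟩ = Tr[ρ
T_t(1 - 2ρ/n)]` (`walk_expectation`).

These moments give the entropy. The real part of `-log(1 - r e^{iφ})` at `cos φ = 1 - 2p/n` yields
`2 ∑ r^m/m T_m(1 - 2p/n) = -log(4r/n) - log(p + η)` with `η = n(1-r)²/(4r)`. Averaging over the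
eigenvalues of `ρ` gives `H(ρ)` up to `nη` and a truncation error (`abs_chebyshev_sub_entropy_le`).
The angle `φ` is of order `√(p/n)`, so resolving eigenvalues of order `ε/n` takes a degree `K` of
only about `n/√ε`, up to a logarithm.

The weights `r^m/m` have total `L`, which is logarithmic. An index register with amplitudes
`√(r^m/(mL))` turns the weighted sum into the expectation `a` of a single self-inverse unitary.
Multiplying that unitary by the reflection about the prepared state gives a second walk, whose
Chebyshev recurrence has the scalar parameter `a`. Phase estimation (`phase_estimation`) with a
clock of size `N` of order `L/ε` finds `a` to precision `ε/(4L)`. Each step of the outer walk costs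
`2(K + 1)` calls, hence about `n/ε^{1.5}` in total. -/

open scoped Kronecker ComplexOrder

noncomputable section

open Matrix

set_option linter.unusedSectionVars false

/-! ### Circuits with alternating oracle calls. -/

section Circuits

variable {ι κ o 𝒰 : Type*} [Fintype ι] [DecidableEq ι] [Fintype κ] [DecidableEq κ]
  [Fintype o] [DecidableEq o]

/-- `AlternatingCircuit O m F`: the operator `F u` is a product of fixed unitaries, interlaced with
`m` calls to `(O u)ᴴ` and `m` calls to `O u` in alternation, the first call being to `(O u)ᴴ`. -/
def AlternatingCircuit (O : 𝒰 → Matrix ι ι ℂ) : ℕ → (𝒰 → Matrix ι ι ℂ) → Prop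
  | 0, F => ∃ V ∈ unitaryGroup ι ℂ, ∀ u, F u = V
  | m + 1, F => ∃ F', AlternatingCircuit O m F' ∧ ∃ V ∈ unitaryGroup ι ℂ,
      ∃ V' ∈ unitaryGroup ι ℂ, ∀ u, F u = V' * (O u * (V * ((O u)ᴴ * F' u)))

namespace AlternatingCircuit

variable {O : 𝒰 → Matrix ι ι ℂ}

theorem gate {V : Matrix ι ι ℂ} (hV : V ∈ unitaryGroup ι ℂ) :
    AlternatingCircuit O 0 fun _ => V :=
  ⟨V, hV, fun _ => rfl⟩

theorem conj {V V₁ V₂ : Matrix ι ι ℂ} (hV : V ∈ unitaryGroup ι ℂ) (h₁ : V₁ ∈ unitaryGroup ι ℂ)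
    (h₂ : V₂ ∈ unitaryGroup ι ℂ) :
    AlternatingCircuit O 1 fun u => V₁ * (O u * (V * ((O u)ᴴ * V₂))) :=
  ⟨_, gate h₂, V, hV, V₁, h₁, fun _ => rfl⟩

theorem congr {m : ℕ} {F G : 𝒰 → Matrix ι ι ℂ} (hF : AlternatingCircuit O m F)
    (h : ∀ u, G u = F u) : AlternatingCircuit O m G :=
  (funext h : G = F) ▸ hF

theorem gate_mul {V : Matrix ι ι ℂ} (hV : V ∈ unitaryGroup ι ℂ) {m : ℕ}
    {F : 𝒰 → Matrix ι ι ℂ} (hF : AlternatingCircuit O m F) :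
    AlternatingCircuit O m fun u => V * F u := by
  cases m with
  | zero =>
    obtain ⟨V', hV', h⟩ := hF
    exact ⟨V * V', mul_mem hV hV', fun u => by simp only [h]⟩
  | succ m =>
    obtain ⟨F', hF', V₁, h₁, V₂, h₂, h⟩ := hF
    exact ⟨F', hF', V₁, h₁, V * V₂, mul_mem hV h₂, fun u => by
      simp only [h, Matrix.mul_assoc]⟩

theorem mul {a b : ℕ} {F G : 𝒰 → Matrix ι ι ℂ} (hF : AlternatingCircuit O a F)
    (hG : AlternatingCircuit O b G) : AlternatingCircuit O (a + b) fun u => F u * G u := by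
  induction a generalizing F with
  | zero =>
    obtain ⟨V, hV, h⟩ := hF
    rw [Nat.zero_add]
    exact (gate_mul hV hG).congr fun u => by rw [h]
  | succ a ih =>
    obtain ⟨F', hF', V₁, h₁, V₂, h₂, h⟩ := hF
    rw [Nat.add_right_comm]
    exact ⟨_, ih hF', V₁, h₁, V₂, h₂, fun u => by simp only [h, Matrix.mul_assoc]⟩

theorem pow {a : ℕ} {F : 𝒰 → Matrix ι ι ℂ} (hF : AlternatingCircuit O a F) (j : ℕ) :
    AlternatingCircuit O (j * a) fun u => F u ^ j := by
  induction j with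
  | zero =>
    rw [Nat.zero_mul]
    exact (gate (one_mem _)).congr fun u => pow_zero _
  | succ j ih =>
    rw [Nat.succ_mul]
    exact (ih.mul hF).congr fun u => pow_succ _ _

/-- Padding inserts `O u * (O u)ᴴ = 1`. It equalizes the number of calls, which is what `select`
needs: the control register then governs only fixed gates, and no controlled call to the oracle
occurs. -/
theorem mono (hO : ∀ u, O u ∈ unitaryGroup ι ℂ) {a b : ℕ} (hab : a ≤ b)
    {F : 𝒰 → Matrix ι ι ℂ} (hF : AlternatingCircuit O a F) : AlternatingCircuit O b F := by
  induction b, hab using Nat.le_induction with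
  | base => exact hF
  | succ b _ ih =>
    refine ⟨F, ih, 1, one_mem _, 1, one_mem _, fun u => ?_⟩
    rw [Matrix.one_mul, Matrix.one_mul, ← Matrix.mul_assoc, ← star_eq_conjTranspose,
      mem_unitaryGroup_iff.1 (hO u), Matrix.one_mul]

theorem _root_.Matrix.blockDiagonal_mem_unitaryGroup {V : o → Matrix ι ι ℂ}
    (hV : ∀ t, V t ∈ unitaryGroup ι ℂ) : blockDiagonal V ∈ unitaryGroup (ι × o) ℂ := by
  rw [mem_unitaryGroup_iff, star_eq_conjTranspose, blockDiagonal_conjTranspose,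
    ← blockDiagonal_mul, ← blockDiagonal_one]
  congr 1
  funext t
  exact mem_unitaryGroup_iff.1 (hV t)

/-- Circuits with the same number of calls can be selected between by a control register. -/
theorem select {m : ℕ} {F : o → 𝒰 → Matrix ι ι ℂ} (hF : ∀ t, AlternatingCircuit O m (F t)) :
    AlternatingCircuit (fun u => blockDiagonal fun _ : o => O u) m
      fun u => blockDiagonal fun t => F t u := by
  induction m generalizing F with
  | zero =>
    choose V hV h using hF
    exact ⟨_, blockDiagonal_mem_unitaryGroup hV, fun u => by simp only [h]⟩
  | succ m ih =>
    choose F' hF' V₁ h₁ V₂ h₂ h using hF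
    refine ⟨_, ih hF', _, blockDiagonal_mem_unitaryGroup h₁, _,
      blockDiagonal_mem_unitaryGroup h₂, fun u => ?_⟩
    simp only [blockDiagonal_conjTranspose, ← blockDiagonal_mul, h]

theorem _root_.Matrix.submatrix_mem_unitaryGroup (e : κ ≃ ι) {V : Matrix ι ι ℂ}
    (hV : V ∈ unitaryGroup ι ℂ) : V.submatrix e e ∈ unitaryGroup κ ℂ := by
  rw [mem_unitaryGroup_iff, star_eq_conjTranspose, conjTranspose_submatrix,
    submatrix_mul_equiv, ← star_eq_conjTranspose, mem_unitaryGroup_iff.1 hV, submatrix_one_equiv]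

theorem submatrix (e : κ ≃ ι) {m : ℕ} {F : 𝒰 → Matrix ι ι ℂ} (hF : AlternatingCircuit O m F) :
    AlternatingCircuit (fun u => (O u).submatrix e e) m fun u => (F u).submatrix e e := by
  induction m generalizing F with
  | zero =>
    obtain ⟨V, hV, h⟩ := hF
    exact ⟨_, submatrix_mem_unitaryGroup e hV, fun u => by simp only [h]⟩
  | succ m ih =>
    obtain ⟨F', hF', V₁, h₁, V₂, h₂, h⟩ := hF
    refine ⟨_, ih hF', _, submatrix_mem_unitaryGroup e h₁, _,
      submatrix_mem_unitaryGroup e h₂, fun u => ?_⟩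
    simp only [h, conjTranspose_submatrix, submatrix_mul_equiv]

end AlternatingCircuit

/-- Every unit vector is a column of a unitary matrix. -/
theorem exists_unitary_mulVec_single (x : ι → ℂ) (hx : ∑ i, ‖x i‖ ^ 2 = 1) (i₀ : ι) :
    ∃ V ∈ unitaryGroup ι ℂ, V *ᵥ Pi.single i₀ 1 = x := by
  have hnorm : ‖(WithLp.toLp 2 x : EuclideanSpace ℂ ι)‖ = 1 := by
    rw [EuclideanSpace.norm_eq, Real.sqrt_eq_one]
    exact hx
  have hv : Orthonormal ℂ (({i₀} : Set ι).domRestrict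
      fun _ : ι => (WithLp.toLp 2 x : EuclideanSpace ℂ ι)) :=
    ⟨fun _ => hnorm, fun i j hij => absurd (Subsingleton.elim i j) hij⟩
  obtain ⟨b, hb⟩ := hv.exists_orthonormalBasis_extension_of_card_eq (by simp)
  refine ⟨Matrix.of fun i j => b j i, ?_, ?_⟩
  · rw [mem_unitaryGroup_iff']
    ext i j
    have h := orthonormal_iff_ite.1 b.orthonormal i j
    rw [PiLp.inner_apply] at h
    rw [mul_apply, one_apply, ← h]
    refine Finset.sum_congr rfl fun l _ => ?_
    simp [mul_comm]
  · ext i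
    rw [mulVec_single_one]
    simp [hb i₀ rfl, Matrix.col]

theorem sum_norm_sq_mulVec_of_mem_unitaryGroup {V : Matrix ι ι ℂ} (hV : V ∈ unitaryGroup ι ℂ)
    (x : ι → ℂ) : ∑ i, ‖(V *ᵥ x) i‖ ^ 2 = ∑ i, ‖x i‖ ^ 2 := by
  have key : ∀ y : ι → ℂ, ((∑ i, ‖y i‖ ^ 2 : ℝ) : ℂ) = star y ⬝ᵥ y := fun y => by
    simp [dotProduct, Complex.conj_mul']
  have : ((∑ i, ‖(V *ᵥ x) i‖ ^ 2 : ℝ) : ℂ) = ((∑ i, ‖x i‖ ^ 2 : ℝ) : ℂ) := by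
    rw [key, key, star_mulVec, dotProduct_mulVec, vecMul_vecMul, ← star_eq_conjTranspose,
      mem_unitaryGroup_iff'.1 hV, vecMul_one]
  exact_mod_cast this

end Circuits

/-! ### From alternating circuits to query algorithms. -/

section Compile

variable {k n : ℕ} [NeZero k] [NeZero n]

theorem QueryAlgorithm.state_congr (w : ℕ) [hw : NeZero w] (q q' : ℕ)
    (gate gate' : ℕ → unitaryGroup ((Fin k × Fin n) × Fin w) ℂ) (inverse : ℕ → Bool)
    (f : (Fin k × Fin n) × Fin w → ℝ) (U : unitaryGroup (Fin k × Fin n) ℂ) (t : ℕ)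
    (h : ∀ s ≤ t, gate s = gate' s) :
    (QueryAlgorithm.mk w hw q gate inverse f).state U t =
      (QueryAlgorithm.mk w hw q' gate' inverse f).state U t := by
  induction t with
  | zero => simp only [QueryAlgorithm.state, h 0 le_rfl]
  | succ t ih =>
    simp only [QueryAlgorithm.state, h (t + 1) le_rfl, ih fun s hs => h s (hs.trans t.le_succ)]
    rfl

/-- Call number `0` is the call to `U` that acts on `x`; the circuit then contributes `m` pairs
`U†`, `U`. Hence the odd calls are the inverse ones and there are `2 * m + 1` in all. -/
theorem AlternatingCircuit.exists_gates {w : ℕ} [hw : NeZero w] {m : ℕ}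
    {F : unitaryGroup (Fin k × Fin n) ℂ →
      Matrix ((Fin k × Fin n) × Fin w) ((Fin k × Fin n) × Fin w) ℂ}
    (hF : AlternatingCircuit (fun U => U.1 ⊗ₖ (1 : Matrix (Fin w) (Fin w) ℂ)) m F)
    (x : (Fin k × Fin n) × Fin w → ℂ) (hx : ∑ i, ‖x i‖ ^ 2 = 1)
    (f : (Fin k × Fin n) × Fin w → ℝ) :
    ∃ gate, ∀ U q, (QueryAlgorithm.mk w hw q gate (fun t => decide (t % 2 = 1)) f).state U
      (2 * m + 1) = F U *ᵥ ((U.1 ⊗ₖ (1 : Matrix (Fin w) (Fin w) ℂ)) *ᵥ x) := by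
  induction m generalizing F with
  | zero =>
    obtain ⟨V, hV, h⟩ := hF
    obtain ⟨Q, hQ, hQx⟩ := exists_unitary_mulVec_single x hx ((0, 0), 0)
    refine ⟨fun t => if t = 0 then ⟨Q, hQ⟩ else ⟨V, hV⟩, fun U q => ?_⟩
    simp [QueryAlgorithm.state, QueryAlgorithm.call, h, hQx]
  | succ m ih =>
    obtain ⟨F', hF', V₁, h₁, V₂, h₂, h⟩ := hF
    obtain ⟨gate, hgate⟩ := ih hF'
    refine ⟨fun t => if t ≤ 2 * m + 1 then gate t else if t = 2 * m + 2 then ⟨V₁, h₁⟩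
      else ⟨V₂, h₂⟩, fun U q => ?_⟩
    have e : 2 * (m + 1) + 1 = (2 * m + 1) + 1 + 1 := by ring
    rw [e, QueryAlgorithm.state, QueryAlgorithm.state,
      QueryAlgorithm.state_congr w q q _ gate _ f U (2 * m + 1) (by
        intro s hs
        simp [hs]), hgate]
    have m1 : (2 * m + 1) % 2 = 1 := by omega
    have m2 : (2 * m + 1 + 1) % 2 = 0 := by omega
    simp [QueryAlgorithm.call, m1, m2, h, mulVec_mulVec, Matrix.mul_assoc,
      conjTranspose_kronecker, star_eq_conjTranspose]

/-- An alternating circuit on `(A ⊗ B) ⊗ W`, run on `(U ⊗ 1) x` for a fixed unit vector `x`, is a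
query algorithm. -/
theorem AlternatingCircuit.exists_queryAlgorithm {ι W : Type*} [Fintype ι] [DecidableEq ι]
    [Fintype W] [DecidableEq W] [Nonempty W] (e : ι ≃ (Fin k × Fin n) × W)
    {O : unitaryGroup (Fin k × Fin n) ℂ → Matrix ι ι ℂ}
    (hO : ∀ U, O U = (U.1 ⊗ₖ (1 : Matrix W W ℂ)).submatrix e e) {m : ℕ}
    {F : unitaryGroup (Fin k × Fin n) ℂ → Matrix ι ι ℂ}
    (hF : AlternatingCircuit O m F) (x : ι → ℂ) (hx : ∑ i, ‖x i‖ ^ 2 = 1) (f : ι → ℝ) :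
    ∃ 𝒜 : QueryAlgorithm k n, 𝒜.queries = 2 * m + 1 ∧ ∀ U S, 𝒜.outputProb U S =
      open Classical in ∑ i, if f i ∈ S then ‖(F U *ᵥ (O U *ᵥ x)) i‖ ^ 2 else 0 := by
  have hw : NeZero (Fintype.card W) := ⟨Fintype.card_ne_zero⟩
  let e' : ι ≃ (Fin k × Fin n) × Fin (Fintype.card W) :=
    e.trans ((Equiv.refl _).prodCongr (Fintype.equivFin W))
  have hO' : ∀ U, (O U).submatrix e'.symm e'.symm =
      U.1 ⊗ₖ (1 : Matrix (Fin (Fintype.card W)) (Fin (Fintype.card W)) ℂ) := by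
    intro U
    ext ⟨i, w⟩ ⟨j, w'⟩
    simp [hO, e', one_apply]
  have hF' := hF.submatrix e'.symm
  simp only [hO'] at hF'
  obtain ⟨gate, hgate⟩ := hF'.exists_gates (x ∘ e'.symm)
    (by rw [← hx]; exact e'.symm.sum_comp fun i => ‖x i‖ ^ 2) (f ∘ e'.symm)
  refine ⟨⟨_, hw, 2 * m + 1, gate, fun t => decide (t % 2 = 1), f ∘ e'.symm⟩, rfl, fun U S => ?_⟩
  rw [QueryAlgorithm.outputProb]
  simp only [hgate, ← hO', submatrix_mulVec_equiv, Equiv.symm_symm, Function.comp_assoc,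
    Equiv.symm_comp_self, Function.comp_id, Function.comp_apply]
  exact e'.symm.sum_comp fun i => open Classical in if f i ∈ S then
    ‖(F U *ᵥ (O U *ᵥ x)) i‖ ^ 2 else 0

end Compile

/-! ### Phase estimation with a path-shaped clock. -/

section PhaseEstimation

/-- Half the adjacency matrix of the path with `N` vertices. -/
def pathMatrix (N : ℕ) : Matrix (Fin N) (Fin N) ℂ :=
  Matrix.of fun s t => (if (t : ℕ) + 1 = s then 1 / 2 else 0) + if (t : ℕ) = s + 1 then 1 / 2 else 0

theorem pathMatrix_isHermitian (N : ℕ) : (pathMatrix N).IsHermitian := by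
  ext s t
  simp only [pathMatrix, conjTranspose_apply, of_apply, star_add]
  rw [add_comm]
  congr 1 <;> split_ifs <;> first | omega | simp

/-- The zero values at `0` and `N + 1` stand in for the missing neighbours of the end vertices, so
the two-term average has no boundary exceptions. -/
theorem pathMatrix_mulVec {N : ℕ} (φ : ℕ → ℂ) (h₀ : φ 0 = 0) (hN : φ (N + 1) = 0) (s : Fin N) :
    (pathMatrix N *ᵥ fun t : Fin N => φ (t + 1)) s = (φ s + φ (s + 2)) / 2 := by
  obtain ⟨s, hs⟩ := s
  simp only [mulVec, dotProduct, pathMatrix, of_apply, add_mul, Finset.sum_add_distrib, add_div]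
  congr 1
  · rw [Fin.sum_univ_eq_sum_range (fun t => (if t + 1 = s then (1 / 2 : ℂ) else 0) * φ (t + 1)) N]
    cases s with
    | zero => simp [h₀]
    | succ s =>
      rw [Finset.sum_eq_single s]
      · simp; ring
      · intro b _ hb
        simp [hb]
      · intro h
        simp at h; omega
  · rw [Fin.sum_univ_eq_sum_range (fun t => (if t = s + 1 then (1 / 2 : ℂ) else 0) * φ (t + 1)) N]
    simp only [ite_mul, zero_mul, Finset.sum_ite_eq', Finset.mem_range]
    split_ifs with h
    · ring
    · have : s + 2 = N + 1 := by omega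
      rw [this, hN, zero_div]

/-- The unnormalized amplitudes of the clock register. -/
def clockWeight (N t : ℕ) : ℝ := t * (N + 1 - t)

theorem sum_clockWeight_sq (N j : ℕ) : ∑ t ∈ Finset.range j, clockWeight N (t + 1) ^ 2 =
    (N + 1 : ℝ) ^ 2 * (j * (j + 1) * (2 * j + 1) / 6) - 2 * (N + 1) * (j * (j + 1) / 2) ^ 2 +
      j * (j + 1) * (2 * j + 1) * (3 * j ^ 2 + 3 * j - 1) / 30 := by
  induction j with
  | zero => simp
  | succ j ih =>
    rw [Finset.sum_range_succ, ih, clockWeight]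
    push_cast
    ring

theorem le_sum_clockWeight_sq (N : ℕ) :
    (N : ℝ) ^ 5 / 30 ≤ ∑ t : Fin N, clockWeight N (t + 1) ^ 2 := by
  rw [Fin.sum_univ_eq_sum_range (fun t => clockWeight N (t + 1) ^ 2), sum_clockWeight_sq]
  have : (0 : ℝ) ≤ N := N.cast_nonneg
  -- The exact sum is `N(N+1)(N+2)(N²+2N+2)/30`; this is its excess over `N ^ 5 / 30`.
  have h : (0 : ℝ) ≤ (5 * N ^ 4 + 10 * N ^ 3 + 10 * N ^ 2 + 4 * N) / 30 := by positivity
  linear_combination h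

/-- The normalized amplitudes of the clock register. -/
def clockAmplitude (N t : ℕ) : ℝ :=
  clockWeight N t / √(∑ s : Fin N, clockWeight N (s + 1) ^ 2)

theorem clockAmplitude_zero (N : ℕ) : clockAmplitude N 0 = 0 := by
  simp [clockAmplitude, clockWeight]

theorem clockAmplitude_last (N : ℕ) : clockAmplitude N (N + 1) = 0 := by
  simp [clockAmplitude, clockWeight]

theorem sum_clockAmplitude_sq {N : ℕ} (hN : 0 < N) :
    ∑ t : Fin N, clockAmplitude N (t + 1) ^ 2 = 1 := by
  have hN' : (0 : ℝ) < N := by exact_mod_cast hN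
  have hZ : 0 < ∑ s : Fin N, clockWeight N (s + 1) ^ 2 :=
    (by positivity : (0 : ℝ) < (N : ℝ) ^ 5 / 30).trans_le (le_sum_clockWeight_sq N)
  simp only [clockAmplitude, div_pow, Real.sq_sqrt hZ.le, ← Finset.sum_div]
  exact div_self hZ.ne'

/-- Consecutive weights differ by `N - 2t`, of size at most `N`, against a squared norm of at least
`N ^ 5 / 30`. The profile vanishes at both ends, so the bound covers the boundary steps too. -/
theorem sq_sub_clockAmplitude_le {N : ℕ} (hN : 0 < N) {t : ℕ} (ht : t ≤ N) :
    (clockAmplitude N (t + 1) - clockAmplitude N t) ^ 2 ≤ 30 / (N : ℝ) ^ 3 := by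
  have hN' : (0 : ℝ) < N := by exact_mod_cast hN
  have ht' : (t : ℝ) ≤ N := by exact_mod_cast ht
  have ht0 : (0 : ℝ) ≤ t := t.cast_nonneg
  have hle := le_sum_clockWeight_sq N
  have hZ : 0 < ∑ s : Fin N, clockWeight N (s + 1) ^ 2 :=
    (by positivity : (0 : ℝ) < (N : ℝ) ^ 5 / 30).trans_le hle
  rw [clockAmplitude, clockAmplitude, ← sub_div, div_pow, Real.sq_sqrt hZ.le,
    div_le_div_iff₀ hZ (by positivity)]
  have h : clockWeight N (t + 1) - clockWeight N t = N - 2 * t := by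
    simp only [clockWeight]
    push_cast
    ring
  have h2 : ((N : ℝ) - 2 * t) ^ 2 ≤ N ^ 2 := by nlinarith
  rw [h]
  calc ((N : ℝ) - 2 * t) ^ 2 * (N : ℝ) ^ 3 ≤ (N : ℝ) ^ 2 * (N : ℝ) ^ 3 := by gcongr
    _ = 30 * ((N : ℝ) ^ 5 / 30) := by ring
    _ ≤ _ := by gcongr

theorem norm_half_add_sq_le (α β : ℝ) (z w : ℂ) :
    ‖((α : ℂ) * z + β * w) / 2‖ ^ 2 ≤ (α ^ 2 * ‖z‖ ^ 2 + β ^ 2 * ‖w‖ ^ 2) / 2 := by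
  have h : ‖((α : ℂ) * z + β * w) / 2‖ ≤ (|α| * ‖z‖ + |β| * ‖w‖) / 2 := by
    rw [norm_div, Complex.norm_ofNat]
    gcongr
    refine (norm_add_le _ _).trans_eq ?_
    rw [norm_mul, norm_mul, Complex.norm_real, Complex.norm_real, Real.norm_eq_abs,
      Real.norm_eq_abs]
  calc _ ≤ ((|α| * ‖z‖ + |β| * ‖w‖) / 2) ^ 2 := by gcongr
    _ ≤ ((|α| * ‖z‖) ^ 2 + (|β| * ‖w‖) ^ 2) / 2 := by
      nlinarith [sq_nonneg (|α| * ‖z‖ - |β| * ‖w‖)]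
    _ = _ := by rw [mul_pow, mul_pow, sq_abs, sq_abs]

theorem star_eigenvectorUnitary_mul {ι : Type*} [Fintype ι] [DecidableEq ι] {A : Matrix ι ι ℂ}
    (hA : A.IsHermitian) : star (hA.eigenvectorUnitary : Matrix ι ι ℂ) * A =
      diagonal (fun i => (hA.eigenvalues i : ℂ)) * star (hA.eigenvectorUnitary : Matrix ι ι ℂ) := by
  have h := hA.spectral_theorem
  rw [Unitary.conjStarAlgAut_apply] at h
  refine (congrArg (star (hA.eigenvectorUnitary : Matrix ι ι ℂ) * ·) h).trans ?_
  simp only [← Matrix.mul_assoc]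
  rw [mem_unitaryGroup_iff'.1 hA.eigenvectorUnitary.2, Matrix.one_mul]
  rfl

/-- Measuring a Hermitian matrix `A` in its eigenbasis on the vector `φ`: the second moment of the
outcome around `a`. -/
theorem sum_eigenvalues_sub_sq {ι : Type*} [Fintype ι] [DecidableEq ι] {A : Matrix ι ι ℂ}
    (hA : A.IsHermitian) (a : ℝ) (φ : ι → ℂ) :
    ∑ i, (hA.eigenvalues i - a) ^ 2 *
      ‖(star (hA.eigenvectorUnitary : Matrix ι ι ℂ) *ᵥ φ) i‖ ^ 2 =
    ∑ i, ‖(A *ᵥ φ) i - a * φ i‖ ^ 2 := by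
  have hV := Unitary.star_mem hA.eigenvectorUnitary.2
  rw [← sum_norm_sq_mulVec_of_mem_unitaryGroup hV fun i => (A *ᵥ φ) i - a * φ i]
  refine Finset.sum_congr rfl fun i _ => ?_
  have h : (fun i => (A *ᵥ φ) i - a * φ i) = A *ᵥ φ - (a : ℂ) • φ := rfl
  rw [h, mulVec_sub, mulVec_smul, mulVec_mulVec, star_eigenvectorUnitary_mul, ← mulVec_mulVec,
    Pi.sub_apply, mulVec_diagonal, Pi.smul_apply, smul_eq_mul, ← sub_mul, norm_mul, mul_pow,
    ← Complex.ofReal_sub, Complex.norm_real, Real.norm_eq_abs, sq_abs]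

variable {Y : Type*} [Fintype Y] [DecidableEq Y]

theorem one_kronecker_mulVec {ι : Type*} [Fintype ι] (B : Matrix ι ι ℂ)
    (Ψ : Y × ι → ℂ) (y : Y) (i : ι) :
    (((1 : Matrix Y Y ℂ) ⊗ₖ B) *ᵥ Ψ) (y, i) = (B *ᵥ fun t => Ψ (y, t)) i := by
  simp [mulVec, dotProduct, Fintype.sum_prod_type, one_apply]

/-- Phase estimation: if the unit vectors `v t` satisfy the Chebyshev recurrence with parameter `a`,
measuring the clock register of `∑ t, clockAmplitude N t |v t⟩|t⟩` in the eigenbasis of the path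
matrix yields `a` up to `O(1 / N)`. -/
theorem phase_estimation {N : ℕ} (hN : 0 < N) (v : ℕ → Y → ℂ) (a : ℝ)
    (hv : ∀ t, ∑ y, ‖v t y‖ ^ 2 = 1)
    (hrec : ∀ t y, v (t + 2) y + v t y = 2 * a * v (t + 1) y) {δ : ℝ} (hδ : 0 < δ) :
    1 - 30 / (N * δ) ^ 2 ≤ ∑ x : Y × Fin N,
      if |(pathMatrix_isHermitian N).eigenvalues x.2 - a| ≤ δ then
        ‖(((1 : Matrix Y Y ℂ) ⊗ₖ
          star ((pathMatrix_isHermitian N).eigenvectorUnitary : Matrix (Fin N) (Fin N) ℂ)) *ᵥ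
          fun x : Y × Fin N => (clockAmplitude N (x.2 + 1) : ℂ) * v (x.2 + 1) x.1) x‖ ^ 2
      else 0 := by
  have hN' : (0 : ℝ) < N := by exact_mod_cast hN
  set Ψ : Y × Fin N → ℂ := fun x => (clockAmplitude N (x.2 + 1) : ℂ) * v (x.2 + 1) x.1 with hΨ
  set hC := pathMatrix_isHermitian N
  set V := star (hC.eigenvectorUnitary : Matrix (Fin N) (Fin N) ℂ) with hVdef
  have hV : V ∈ unitaryGroup (Fin N) ℂ := Unitary.star_mem hC.eigenvectorUnitary.2
  set P : Y × Fin N → ℝ := fun x => ‖(((1 : Matrix Y Y ℂ) ⊗ₖ V) *ᵥ Ψ) x‖ ^ 2 with hP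
  have htotal : ∑ x, P x = 1 := by
    simp only [hP, Fintype.sum_prod_type, one_kronecker_mulVec,
      sum_norm_sq_mulVec_of_mem_unitaryGroup hV]
    rw [Finset.sum_comm]
    simp only [hΨ, norm_mul, mul_pow, ← Finset.mul_sum, hv, mul_one, Complex.norm_real,
      Real.norm_eq_abs, sq_abs]
    exact sum_clockAmplitude_sq hN
  -- By the recurrence, `(pathMatrix N - a)` applied to the clock state leaves at each `t` only
  -- increments of the amplitudes, times unit vectors. Each of the `N` positions thus contributes at
  -- most `30 / N ^ 3`.
  have hmoment : ∑ x, (hC.eigenvalues x.2 - a) ^ 2 * P x ≤ 30 / N ^ 2 := by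
    simp only [hP, Fintype.sum_prod_type, one_kronecker_mulVec]
    simp only [hVdef, sum_eigenvalues_sub_sq]
    rw [Finset.sum_comm]
    have hbound : ∀ t : Fin N,
        ∑ y, ‖(pathMatrix N *ᵥ fun t => Ψ (y, t)) t - a * Ψ (y, t)‖ ^ 2 ≤ 30 / N ^ 3 := by
      intro t
      have h1 := sq_sub_clockAmplitude_le hN t.2.le
      have h2 := sq_sub_clockAmplitude_le hN (t := t + 1) t.2
      have heq : ∀ y, (pathMatrix N *ᵥ fun t => Ψ (y, t)) t - a * Ψ (y, t) =
          (((-(clockAmplitude N (t + 1) - clockAmplitude N t) : ℝ) : ℂ) * v t y +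
            ((clockAmplitude N (t + 1 + 1) - clockAmplitude N (t + 1) : ℝ) : ℂ) *
              v (t + 2) y) / 2 := by
        intro y
        rw [pathMatrix_mulVec (fun s => (clockAmplitude N s : ℂ) * v s y)
          (by simp [clockAmplitude_zero]) (by simp [clockAmplitude_last])]
        simp only [hΨ]
        push_cast
        linear_combination (clockAmplitude N (t + 1) : ℂ) / 2 * hrec t y
      calc _ ≤ ∑ y, ((-(clockAmplitude N (t + 1) - clockAmplitude N t)) ^ 2 * ‖v t y‖ ^ 2 +
            (clockAmplitude N (t + 1 + 1) - clockAmplitude N (t + 1)) ^ 2 *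
              ‖v (t + 2) y‖ ^ 2) / 2 :=
            Finset.sum_le_sum fun y _ => by rw [heq]; exact norm_half_add_sq_le _ _ _ _
        _ = ((clockAmplitude N (t + 1) - clockAmplitude N t) ^ 2 +
            (clockAmplitude N (t + 1 + 1) - clockAmplitude N (t + 1)) ^ 2) / 2 := by
          rw [← Finset.sum_div, Finset.sum_add_distrib, ← Finset.mul_sum, ← Finset.mul_sum, hv, hv,
            mul_one, mul_one, neg_sq]
        _ ≤ _ := by linarith
    refine (Finset.sum_le_sum fun t _ => hbound t).trans_eq ?_
    rw [Finset.sum_const, Finset.card_univ, Fintype.card_fin, nsmul_eq_mul]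
    field_simp
  have hP0 : ∀ x, 0 ≤ P x := fun x => by positivity
  -- Chebyshev's tail inequality, in pointwise form.
  have hcheb : ∀ x, P x - (hC.eigenvalues x.2 - a) ^ 2 * P x / δ ^ 2 ≤
      if |hC.eigenvalues x.2 - a| ≤ δ then P x else 0 := by
    intro x
    split_ifs with h
    · have := hP0 x
      have : 0 ≤ (hC.eigenvalues x.2 - a) ^ 2 * P x / δ ^ 2 := by positivity
      linarith
    · rw [sub_nonpos, le_div_iff₀ (by positivity), mul_comm]
      refine mul_le_mul_of_nonneg_right ?_ (hP0 x)
      rw [← sq_abs (_ - a)]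
      exact pow_le_pow_left₀ hδ.le (not_le.1 h).le 2
  calc 1 - 30 / (N * δ) ^ 2 = 1 - 30 / N ^ 2 / δ ^ 2 := by rw [mul_pow, div_div]
    _ ≤ 1 - (∑ x, (hC.eigenvalues x.2 - a) ^ 2 * P x) / δ ^ 2 := by gcongr
    _ = ∑ x, (P x - (hC.eigenvalues x.2 - a) ^ 2 * P x / δ ^ 2) := by
      rw [Finset.sum_sub_distrib, htotal, Finset.sum_div]
    _ ≤ _ := Finset.sum_le_sum fun x _ => hcheb x

end PhaseEstimation

/-! ### Products of two reflections. -/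

section Walk

variable {Y J o : Type*} [Fintype Y] [DecidableEq Y] [Fintype J] [DecidableEq J]
  [Fintype o] [DecidableEq o]

/-- The reflection about the range of an isometry `P`. -/
def reflectionMatrix (P : Matrix Y J ℂ) : Matrix Y Y ℂ :=
  (2 : ℂ) • (P * Pᴴ) - 1

theorem reflectionMatrix_conjTranspose (P : Matrix Y J ℂ) :
    (reflectionMatrix P)ᴴ = reflectionMatrix P := by
  simp [reflectionMatrix, conjTranspose_smul]

theorem reflectionMatrix_mul {P : Matrix Y J ℂ} (hP : Pᴴ * P = 1) : reflectionMatrix P * P = P := by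
  rw [reflectionMatrix, Matrix.sub_mul, Matrix.smul_mul, Matrix.mul_assoc, hP, Matrix.mul_one,
    Matrix.one_mul, two_smul, add_sub_cancel_right]

theorem reflectionMatrix_mul_self {P : Matrix Y J ℂ} (hP : Pᴴ * P = 1) :
    reflectionMatrix P * reflectionMatrix P = 1 := by
  nth_rw 2 [reflectionMatrix]
  rw [Matrix.mul_sub, Matrix.mul_smul, ← Matrix.mul_assoc, reflectionMatrix_mul hP,
    Matrix.mul_one, reflectionMatrix, sub_sub_cancel]

theorem reflectionMatrix_mem_unitaryGroup {P : Matrix Y J ℂ} (hP : Pᴴ * P = 1) :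
    reflectionMatrix P ∈ unitaryGroup Y ℂ := by
  rw [mem_unitaryGroup_iff, star_eq_conjTranspose, reflectionMatrix_conjTranspose,
    reflectionMatrix_mul_self hP]

theorem neg_mem_unitaryGroup {V : Matrix Y Y ℂ} (hV : V ∈ unitaryGroup Y ℂ) :
    -V ∈ unitaryGroup Y ℂ := by
  rw [mem_unitaryGroup_iff, star_neg, Matrix.neg_mul, Matrix.mul_neg, neg_neg]
  exact mem_unitaryGroup_iff.1 hV

theorem conjTranspose_mul_self_of_unitary_mul {V : Matrix Y Y ℂ} (hV : V ∈ unitaryGroup Y ℂ)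
    {P : Matrix Y J ℂ} (hP : Pᴴ * P = 1) : (V * P)ᴴ * (V * P) = 1 := by
  rw [conjTranspose_mul, Matrix.mul_assoc, ← Matrix.mul_assoc Vᴴ, ← star_eq_conjTranspose V,
    mem_unitaryGroup_iff'.1 hV, Matrix.one_mul, hP]

theorem reflectionMatrix_unitary_mul {V : Matrix Y Y ℂ} (hV : V ∈ unitaryGroup Y ℂ)
    (P : Matrix Y J ℂ) : reflectionMatrix (V * P) = V * (reflectionMatrix P * Vᴴ) := by
  have h := mem_unitaryGroup_iff.1 hV
  rw [star_eq_conjTranspose] at h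
  simp only [reflectionMatrix, conjTranspose_mul, Matrix.sub_mul, Matrix.mul_sub, Matrix.smul_mul,
    Matrix.mul_smul, Matrix.mul_assoc, Matrix.one_mul, h]

/-- The Chebyshev recurrence satisfied by the powers of a product of two reflections. -/
theorem walk_recurrence {S : Matrix Y Y ℂ} (hS : S * S = 1) {P : Matrix Y J ℂ} (hP : Pᴴ * P = 1)
    (t : ℕ) : (S * reflectionMatrix P) ^ (t + 2) * P + (S * reflectionMatrix P) ^ t * P =
      (2 : ℂ) • ((S * reflectionMatrix P) ^ (t + 1) * (P * (Pᴴ * (S * P)))) := by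
  set R := reflectionMatrix P with hR
  have h₁ : S * R * (R * S) = 1 := by
    rw [Matrix.mul_assoc, ← Matrix.mul_assoc R, hR, reflectionMatrix_mul_self hP, Matrix.one_mul,
      hS]
  -- Since `R P = P`, the left side is `(1 + R) S P`, and `1 + R = 2 P Pᴴ`. Together with `(S R)⁻¹ =
  -- R S` this is the whole recurrence.
  have h₂ : S * R * P + R * S * P = (2 : ℂ) • (P * (Pᴴ * (S * P))) := by
    rw [Matrix.mul_assoc, hR, reflectionMatrix_mul hP, Matrix.mul_assoc, reflectionMatrix,
      Matrix.sub_mul, Matrix.one_mul, Matrix.smul_mul, add_sub_cancel, Matrix.mul_assoc]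
  rw [← Matrix.mul_smul, ← h₂, Matrix.mul_add]
  congr 1
  · rw [← Matrix.mul_assoc, ← pow_succ]
  · rw [← Matrix.mul_assoc, pow_succ, Matrix.mul_assoc _ (S * R) (R * S), h₁, Matrix.mul_one]

/-- The word `R S R ⋯ S R` is a palindrome in involutions, so it is its own inverse. The outer walk
needs an involution, which `(S * R) ^ t` alone need not be. -/
theorem walk_palindrome_mul_self {R S : Matrix Y Y ℂ} (hR : R * R = 1) (hS : S * S = 1) (t : ℕ) :
    R * (S * R) ^ t * (R * (S * R) ^ t) = 1 := by
  have h : (S * R) ^ t * R * (S * R) ^ t = R := by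
    induction t with
    | zero => simp
    | succ t ih =>
      rw [pow_succ]
      nth_rw 2 [← pow_succ]
      rw [pow_succ']
      calc (S * R) ^ t * (S * R) * R * (S * R * (S * R) ^ t)
          = (S * R) ^ t * (S * (R * R) * S) * R * (S * R) ^ t := by simp only [Matrix.mul_assoc]
        _ = R := by rw [hR, Matrix.mul_one, hS, Matrix.mul_one, ih]
  rw [Matrix.mul_assoc, ← Matrix.mul_assoc _ R, h, hR]

theorem blockDiagonal_mulVec_apply (M : o → Matrix Y Y ℂ) (x : Y × o → ℂ) (y : Y) (t : o) :
    (blockDiagonal M *ᵥ x) (y, t) = (M t *ᵥ fun y => x (y, t)) y := by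
  simp [mulVec, dotProduct, Fintype.sum_prod_type, blockDiagonal_apply, ite_mul]

end Walk

/-! ### Registers and isometries of the inner walk. -/

section EntropyWalk

variable {k n : ℕ} [NeZero k] [NeZero n]

/-- The isometry `u ↦ u ⊗ Φ` with `Φ` the maximally entangled state. -/
def entangle (k n : ℕ) : Matrix ((Fin k × Fin n) × (Fin n × Fin n)) (Fin k × Fin n) ℂ :=
  Matrix.of fun x j => if x.1 = j ∧ x.2.1 = x.2.2 then ((√n)⁻¹ : ℂ) else 0

/-- The isometry `w ↦ |0⟩|0⟩ ⊗ w`. -/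
def groundEmbedding (k n : ℕ) [NeZero k] [NeZero n] :
    Matrix ((Fin k × Fin n) × (Fin n × Fin n)) (Fin n × Fin n) ℂ :=
  Matrix.of fun x j => if x.1 = (0, 0) ∧ x.2 = j then 1 else 0

/-- The permutation that exchanges the system register with the first auxiliary one. -/
def swapPerm (k n : ℕ) :
    (Fin k × Fin n) × (Fin n × Fin n) ≃ (Fin k × Fin n) × (Fin n × Fin n) where
  toFun x := ((x.1.1, x.2.1), (x.1.2, x.2.2))
  invFun x := ((x.1.1, x.2.1), (x.1.2, x.2.2))
  left_inv _ := rfl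
  right_inv _ := rfl

/-- The permutation matrix of `swapPerm`. -/
def swapMatrix (k n : ℕ) :
    Matrix ((Fin k × Fin n) × (Fin n × Fin n)) ((Fin k × Fin n) × (Fin n × Fin n)) ℂ :=
  (1 : Matrix _ _ ℂ).submatrix (swapPerm k n) id

/-- The lift of an operator on `A ⊗ B` to `(A ⊗ B) ⊗ (B ⊗ B)`. -/
def liftOracle (U : unitaryGroup (Fin k × Fin n) ℂ) :
    Matrix ((Fin k × Fin n) × (Fin n × Fin n)) ((Fin k × Fin n) × (Fin n × Fin n)) ℂ :=
  blockDiagonal fun _ => U.1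

/-- The matrix of coefficients of `U|0⟩|0⟩`. -/
def purification (U : unitaryGroup (Fin k × Fin n) ℂ) : Matrix (Fin k) (Fin n) ℂ :=
  Matrix.of fun a b => U.1 (a, b) (0, 0)


theorem entangle_isometry : (entangle k n)ᴴ * entangle k n = 1 := by
  ext ⟨a, b⟩ ⟨a', b'⟩
  have hn : (n : ℂ) ≠ 0 := Nat.cast_ne_zero.2 (NeZero.ne n)
  have hs : ((√n : ℝ) : ℂ)⁻¹ * ((√n : ℝ) : ℂ)⁻¹ = (n : ℂ)⁻¹ := by
    rw [← mul_inv, ← Complex.ofReal_mul, Real.mul_self_sqrt n.cast_nonneg, Complex.ofReal_natCast]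
  by_cases h : (a, b) = (a', b')
  · obtain ⟨rfl, rfl⟩ := Prod.mk.inj h
    simp [mul_apply, entangle, Fintype.sum_prod_type, ite_and, hs, hn]
  · rw [one_apply_ne h]
    simp only [mul_apply, conjTranspose_apply, entangle, of_apply]
    refine Finset.sum_eq_zero fun x _ => ?_
    split_ifs with h₁ h₂
    · exact absurd (h₁.1.symm.trans h₂.1) h
    all_goals simp

theorem groundEmbedding_isometry : (groundEmbedding k n)ᴴ * groundEmbedding k n = 1 := by
  ext ⟨a, b⟩ ⟨a', b'⟩
  simp [mul_apply, groundEmbedding, Fintype.sum_prod_type, ite_and, one_apply]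
  split_ifs <;> simp_all

theorem swapMatrix_mul {J : Type*} [Fintype J]
    (M : Matrix ((Fin k × Fin n) × (Fin n × Fin n)) J ℂ) :
    swapMatrix k n * M = M.submatrix (swapPerm k n) id := by
  ext i j
  simp [swapMatrix, mul_apply, one_apply]

theorem swapMatrix_mem_unitaryGroup : swapMatrix k n ∈ unitaryGroup _ ℂ := by
  rw [mem_unitaryGroup_iff, star_eq_conjTranspose, swapMatrix_mul, swapMatrix,
    conjTranspose_submatrix, conjTranspose_one, submatrix_submatrix]
  exact submatrix_one_equiv _

theorem liftOracle_mem_unitaryGroup (U : unitaryGroup (Fin k × Fin n) ℂ) :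
    liftOracle U ∈ unitaryGroup _ ℂ :=
  blockDiagonal_mem_unitaryGroup fun _ => U.2

/-- The isometry `w ↦ |ψ⟩ ⊗ w`, where `|ψ⟩ = U|0⟩|0⟩` occupies the register `A` and the first
auxiliary one. -/
def purificationEmbedding (U : unitaryGroup (Fin k × Fin n) ℂ) :
    Matrix ((Fin k × Fin n) × (Fin n × Fin n)) (Fin n × Fin n) ℂ :=
  swapMatrix k n * (liftOracle U * groundEmbedding k n)

theorem purificationEmbedding_apply (U : unitaryGroup (Fin k × Fin n) ℂ) (a b b₁ b₂ c₁ c₂) :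
    purificationEmbedding U ((a, b), (b₁, b₂)) (c₁, c₂) =
      if b = c₁ ∧ b₂ = c₂ then purification U a b₁ else 0 := by
  rw [purificationEmbedding, swapMatrix_mul]
  simp [swapPerm, liftOracle, mul_apply, groundEmbedding, Fintype.sum_prod_type,
    blockDiagonal_apply, purification, ite_and]

/-- Contracting the two auxiliary registers with `Φ` hands the second one's index to `purification
U`, at the price of `1/√n`. This overlap is the source of the factor `2 / n` in the walk. -/
theorem entangle_purificationEmbedding (U : unitaryGroup (Fin k × Fin n) ℂ) (a b c₁ c₂) :
    ((entangle k n)ᴴ * purificationEmbedding U) (a, b) (c₁, c₂) =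
      if b = c₁ then (√n : ℂ)⁻¹ * purification U a c₂ else 0 := by
  simp only [mul_apply, entangle, Fintype.sum_prod_type, conjTranspose_apply, of_apply,
    purificationEmbedding_apply, ite_and, apply_ite star, star_zero, ite_mul,
    zero_mul, mul_ite, mul_zero, Finset.sum_ite_eq, Finset.sum_ite_eq', Finset.mem_univ, if_true,
    Finset.sum_ite_irrel, Finset.sum_const_zero]
  simp

end EntropyWalk

/-! ### Chebyshev moments of the state as walk expectations. -/

section EntropyWalkExpectation

variable {k n : ℕ} [NeZero k] [NeZero n]

/-- The vector on `A ⊗ B` whose matrix of coefficients is that of `U|0⟩|0⟩`, times `Z`. -/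
def twistedPurification (U : unitaryGroup (Fin k × Fin n) ℂ) (Z : Matrix (Fin n) (Fin n) ℂ) :
    Fin k × Fin n → ℂ :=
  fun x => (purification U * Z) x.1 x.2

/-- The reflection that fixes the orthogonal complement of `|ψ⟩ ⊗ ℂⁿ ⊗ ℂⁿ`. -/
def purificationReflection (U : unitaryGroup (Fin k × Fin n) ℂ) :
    Matrix ((Fin k × Fin n) × (Fin n × Fin n)) ((Fin k × Fin n) × (Fin n × Fin n)) ℂ :=
  -reflectionMatrix (purificationEmbedding U)

theorem purificationEmbedding_isometry (U : unitaryGroup (Fin k × Fin n) ℂ) :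
    (purificationEmbedding U)ᴴ * purificationEmbedding U = 1 :=
  conjTranspose_mul_self_of_unitary_mul swapMatrix_mem_unitaryGroup
    (conjTranspose_mul_self_of_unitary_mul (liftOracle_mem_unitaryGroup U)
      groundEmbedding_isometry)

theorem purificationReflection_mul_self (U : unitaryGroup (Fin k × Fin n) ℂ) :
    purificationReflection U * purificationReflection U = 1 := by
  rw [purificationReflection, Matrix.neg_mul, Matrix.mul_neg, neg_neg,
    reflectionMatrix_mul_self (purificationEmbedding_isometry U)]

theorem purificationReflection_eq (U : unitaryGroup (Fin k × Fin n) ℂ) :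
    purificationReflection U = swapMatrix k n * (liftOracle U *
      (-reflectionMatrix (groundEmbedding k n) * ((liftOracle U)ᴴ * (swapMatrix k n)ᴴ))) := by
  rw [purificationReflection, purificationEmbedding,
    reflectionMatrix_unitary_mul swapMatrix_mem_unitaryGroup,
    reflectionMatrix_unitary_mul (liftOracle_mem_unitaryGroup U)]
  simp only [Matrix.neg_mul, Matrix.mul_neg, Matrix.mul_assoc]

/-- With `M` the overlap of the two isometries, the compression is `1 - 2 M Mᴴ`. On coefficient
matrices `M Mᴴ` is left multiplication by `N Nᴴ / n`, where `N = purification U`, and `N Nᴴ (N Z) =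
N (Nᴴ N) Z` moves it to the right of `N`. -/
theorem entangle_purificationReflection_mulVec (U : unitaryGroup (Fin k × Fin n) ℂ)
    (Z : Matrix (Fin n) (Fin n) ℂ) :
    ((entangle k n)ᴴ * (purificationReflection U * entangle k n)) *ᵥ twistedPurification U Z =
      twistedPurification U
        ((1 - (2 / n : ℝ) • ((purification U)ᴴ * purification U)) * Z) := by
  set N := purification U with hN
  set M := (entangle k n)ᴴ * purificationEmbedding U with hM
  have hs : ((√n : ℝ) : ℂ)⁻¹ * ((√n : ℝ) : ℂ)⁻¹ = (n : ℂ)⁻¹ := by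
    rw [← mul_inv, ← Complex.ofReal_mul, Real.mul_self_sqrt n.cast_nonneg, Complex.ofReal_natCast]
  have h₁ : (entangle k n)ᴴ * (purificationReflection U * entangle k n) =
      1 - (2 : ℂ) • (M * Mᴴ) := by
    rw [purificationReflection, reflectionMatrix, neg_sub, Matrix.sub_mul, Matrix.mul_sub,
      Matrix.one_mul, entangle_isometry, hM, conjTranspose_mul, conjTranspose_conjTranspose]
    simp only [Matrix.smul_mul, Matrix.mul_smul, Matrix.mul_assoc]
  have hM' : ∀ a b c₁ c₂, M (a, b) (c₁, c₂) =
      if b = c₁ then ((√n : ℝ) : ℂ)⁻¹ * N a c₂ else 0 :=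
    entangle_purificationEmbedding U
  have h₂ : ∀ c₁ c₂, (Mᴴ *ᵥ twistedPurification U Z) (c₁, c₂) =
      ((√n : ℝ) : ℂ)⁻¹ * (Nᴴ * (N * Z)) c₂ c₁ := by
    intro c₁ c₂
    simp only [mulVec, dotProduct, conjTranspose_apply, Fintype.sum_prod_type, hM',
      apply_ite star, star_zero, ite_mul, zero_mul,
      Finset.sum_ite_eq', Finset.mem_univ, if_true, twistedPurification]
    rw [mul_apply, Finset.mul_sum]
    refine Finset.sum_congr rfl fun a _ => ?_
    simp [mul_assoc, hN]
  rw [h₁, sub_mulVec, one_mulVec, smul_mulVec, ← mulVec_mulVec]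
  ext ⟨a, b⟩
  have h₃ : (M *ᵥ (Mᴴ *ᵥ twistedPurification U Z)) (a, b) =
      (n : ℂ)⁻¹ * (N * (Nᴴ * (N * Z))) a b := by
    rw [mulVec, dotProduct, Fintype.sum_prod_type]
    simp only [h₂, hM', ite_mul, zero_mul]
    rw [Finset.sum_comm]
    simp only [Finset.sum_ite_eq, Finset.mem_univ, if_true]
    rw [mul_apply, Finset.mul_sum]
    refine Finset.sum_congr rfl fun c _ => ?_
    rw [← hs]
    ring
  rw [Pi.sub_apply, Pi.smul_apply, h₃]
  simp only [twistedPurification, ← hN, Matrix.sub_mul, Matrix.mul_sub, Matrix.one_mul,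
    Matrix.sub_apply, Matrix.smul_mul, Matrix.mul_smul, Matrix.smul_apply, Matrix.mul_assoc,
    Complex.real_smul, smul_eq_mul]
  push_cast
  ring

-- The family `twistedPurification U Z` is invariant under the compression, so `walk_recurrence`
-- becomes the defining recurrence of the Chebyshev polynomials. The induction needs all `Z`,
-- because each step multiplies `Z` by the compressed operator.
open Polynomial in
theorem entangle_walk_mulVec (U : unitaryGroup (Fin k × Fin n) ℂ) (t : ℕ)
    (Z : Matrix (Fin n) (Fin n) ℂ) :
    ((entangle k n)ᴴ * ((purificationReflection U * reflectionMatrix (entangle k n)) ^ t *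
      entangle k n)) *ᵥ twistedPurification U Z =
    twistedPurification U (aeval (1 - (2 / n : ℝ) • ((purification U)ᴴ * purification U))
      (Chebyshev.T ℝ t) * Z) := by
  induction t using Nat.twoStepInduction generalizing Z with
  | zero => simp [entangle_isometry]
  | one =>
    rw [pow_one, Matrix.mul_assoc, reflectionMatrix_mul entangle_isometry,
      entangle_purificationReflection_mulVec]
    simp
  | more t ih₁ ih₂ =>
    have h := congrArg (fun A => ((entangle k n)ᴴ * A) *ᵥ twistedPurification U Z)
      (walk_recurrence (purificationReflection_mul_self U) (entangle_isometry (k := k) (n := n)) t)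
    simp only [Matrix.mul_add, add_mulVec, Matrix.mul_smul, smul_mulVec] at h
    rw [← Matrix.mul_assoc _ (entangle k n), ← Matrix.mul_assoc (entangle k n)ᴴ (_ * entangle k n),
      ← mulVec_mulVec _ (_ * (_ ^ (t + 1) * _)), entangle_purificationReflection_mulVec, ih₁, ih₂,
      ← eq_sub_iff_add_eq] at h
    rw [h]
    have hT : Chebyshev.T ℝ ((t + 2 : ℕ) : ℤ) =
        Chebyshev.T ℝ ((t + 1 : ℕ) : ℤ) * X + Chebyshev.T ℝ ((t + 1 : ℕ) : ℤ) * X - Chebyshev.T ℝ (t : ℤ) := by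
      push_cast
      rw [Chebyshev.T_add_two]
      ring
    rw [hT, map_sub, map_add, map_mul, aeval_X]
    ext ⟨a, b⟩
    generalize 1 - (2 / n : ℝ) • ((purification U)ᴴ * purification U) = x
    simp only [twistedPurification, Pi.sub_apply, Pi.smul_apply, Matrix.sub_mul, Matrix.mul_sub,
      Matrix.sub_apply, Matrix.mul_assoc, smul_eq_mul, two_mul, Matrix.add_mul, Matrix.mul_add,
      Matrix.add_apply]

/-- Tracing out the row register leaves the conjugation on the second index of `ρ`, whence the
transpose. It disappears later under the trace. -/
theorem purification_gram {U : unitaryGroup (Fin k × Fin n) ℂ} {ρ : Matrix (Fin n) (Fin n) ℂ}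
    (h : IsPurifiedOracle U ρ) : (purification U)ᴴ * purification U = ρᵀ := by
  rw [← h]
  ext i j
  simp [partialTraceA, ketBra, vecMulVec_apply, mul_apply, purification, mul_comm]

theorem aeval_transpose {ι : Type*} [Fintype ι] [DecidableEq ι] (A : Matrix ι ι ℂ)
    (p : Polynomial ℝ) : Polynomial.aeval Aᵀ p = (Polynomial.aeval A p)ᵀ := by
  simp only [Polynomial.aeval_eq_sum_range, transpose_sum, transpose_smul, transpose_pow]

/-- The expectation of a palindromic power of the walk is a Chebyshev moment of `ρ`. -/
theorem walk_expectation {U : unitaryGroup (Fin k × Fin n) ℂ} {ρ : Matrix (Fin n) (Fin n) ℂ}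
    (h : IsPurifiedOracle U ρ) (t : ℕ) :
    star (entangle k n *ᵥ twistedPurification U 1) ⬝ᵥ
      ((reflectionMatrix (entangle k n) *
        (purificationReflection U * reflectionMatrix (entangle k n)) ^ t) *ᵥ
          (entangle k n *ᵥ twistedPurification U 1)) =
    (ρ * Polynomial.aeval (1 - (2 / n : ℝ) • ρ) (Polynomial.Chebyshev.T ℝ t)).trace := by
  -- The leading reflection fixes the range of `entangle k n`, so completing the power to a
  -- palindrome does not change the expectation.
  have hG : (entangle k n)ᴴ * reflectionMatrix (entangle k n) = (entangle k n)ᴴ := by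
    have := congrArg conjTranspose (reflectionMatrix_mul (entangle_isometry (k := k) (n := n)))
    rwa [conjTranspose_mul, reflectionMatrix_conjTranspose] at this
  have hx : 1 - (2 / n : ℝ) • ρᵀ = (1 - (2 / n : ℝ) • ρ)ᵀ := by
    rw [transpose_sub, transpose_smul, transpose_one]
  rw [star_mulVec, ← dotProduct_mulVec, mulVec_mulVec, mulVec_mulVec, ← Matrix.mul_assoc,
    hG, Matrix.mul_assoc, entangle_walk_mulVec, purification_gram h,
    Matrix.mul_one, hx, aeval_transpose]
  set A := Polynomial.aeval (1 - (2 / n : ℝ) • ρ) (Polynomial.Chebyshev.T ℝ t)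
  have : star (twistedPurification U 1) ⬝ᵥ twistedPurification U Aᵀ =
      ((purification U)ᴴ * purification U * Aᵀ).trace := by
    rw [Matrix.mul_assoc]
    simp only [dotProduct, twistedPurification, Matrix.mul_one, Fintype.sum_prod_type, trace,
      diag_apply, mul_apply (M := (purification U)ᴴ), conjTranspose_apply, Pi.star_apply]
    exact Finset.sum_comm
  rw [this, purification_gram h, ← transpose_mul, trace_transpose, trace_mul_comm]

theorem entangle_mulVec_apply (u : Fin k × Fin n → ℂ) (x) :
    (entangle k n *ᵥ u) x = if x.2.1 = x.2.2 then (√n : ℂ)⁻¹ * u x.1 else 0 := by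
  simp [mulVec, dotProduct, entangle, ite_and]

end EntropyWalkExpectation

/-! ### The outer walk and the estimator of weighted Chebyshev moments. -/

section EntropyAlgorithm

variable {k n K N : ℕ} [NeZero k] [NeZero n]

/-- The state `|0⟩|0⟩ ⊗ Φ ⊗ ∑ i, √(q i) |i⟩`, as a one-column matrix. -/
def initialColumn (k n : ℕ) [NeZero k] [NeZero n] (q : Fin K → ℝ) :
    Matrix (((Fin k × Fin n) × (Fin n × Fin n)) × Fin K) Unit ℂ :=
  Matrix.of fun x _ => (entangle k n *ᵥ Pi.single (0, 0) 1) x.1 * (√(q x.2) : ℝ)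

/-- The oracle, lifted to the registers of the linear combination of walks. -/
def liftOracleIndexed (K : ℕ) (U : unitaryGroup (Fin k × Fin n) ℂ) :
    Matrix (((Fin k × Fin n) × (Fin n × Fin n)) × Fin K)
      (((Fin k × Fin n) × (Fin n × Fin n)) × Fin K) ℂ :=
  blockDiagonal fun _ => liftOracle U

/-- The state `ξ ⊗ ∑ i, √(q i) |i⟩`, as a one-column matrix. -/
def preparedColumn (q : Fin K → ℝ) (U : unitaryGroup (Fin k × Fin n) ℂ) :
    Matrix (((Fin k × Fin n) × (Fin n × Fin n)) × Fin K) Unit ℂ :=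
  liftOracleIndexed K U * initialColumn k n q

/-- Palindromic powers of the walk, selected by an index register. -/
def selectedWalk (K : ℕ) (U : unitaryGroup (Fin k × Fin n) ℂ) :
    Matrix (((Fin k × Fin n) × (Fin n × Fin n)) × Fin K)
      (((Fin k × Fin n) × (Fin n × Fin n)) × Fin K) ℂ :=
  blockDiagonal fun i : Fin K => reflectionMatrix (entangle k n) *
    (purificationReflection U * reflectionMatrix (entangle k n)) ^ (i + 1 : ℕ)

theorem liftOracleIndexed_mem_unitaryGroup (U : unitaryGroup (Fin k × Fin n) ℂ) :
    liftOracleIndexed K U ∈ unitaryGroup _ ℂ :=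
  blockDiagonal_mem_unitaryGroup fun _ => liftOracle_mem_unitaryGroup U

theorem conjTranspose_mul_self_unit {Y : Type*} [Fintype Y] (P : Matrix Y Unit ℂ)
    (h : ∑ y, ‖P y ()‖ ^ 2 = 1) : Pᴴ * P = 1 := by
  ext
  simp only [mul_apply, conjTranspose_apply, one_apply, if_true]
  rw [← Complex.ofReal_one, ← h, Complex.ofReal_sum]
  exact Finset.sum_congr rfl fun y _ => by simp [Complex.conj_mul']

theorem sum_norm_sq_entangle (u : Fin k × Fin n → ℂ) :
    ∑ y, ‖(entangle k n *ᵥ u) y‖ ^ 2 = ∑ x, ‖u x‖ ^ 2 := by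
  have hn : (n : ℝ) ≠ 0 := Nat.cast_ne_zero.2 (NeZero.ne n)
  rw [Fintype.sum_prod_type]
  refine Finset.sum_congr rfl fun x _ => ?_
  simp only [Fintype.sum_prod_type, entangle_mulVec_apply, apply_ite norm, ite_pow, norm_zero,
    ne_eq, OfNat.ofNat_ne_zero, not_false_eq_true, zero_pow, Finset.sum_ite_eq, Finset.mem_univ,
    if_true, Finset.sum_const, Finset.card_univ, Fintype.card_fin, nsmul_eq_mul, norm_mul,
    norm_inv, Complex.norm_real, Real.norm_eq_abs, mul_pow, inv_pow, sq_abs,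
    Real.sq_sqrt n.cast_nonneg]
  rw [mul_inv_cancel_left₀ hn]

theorem sum_norm_sq_initialColumn {q : Fin K → ℝ} (hq : ∀ i, 0 ≤ q i) (hq1 : ∑ i, q i = 1) :
    ∑ y, ‖initialColumn k n q y ()‖ ^ 2 = 1 := by
  simp only [initialColumn, of_apply, norm_mul, mul_pow, Complex.norm_real, Real.norm_eq_abs,
    sq_abs, Real.sq_sqrt (hq _)]
  rw [Fintype.sum_prod_type]
  simp only [← Finset.mul_sum, hq1, mul_one, sum_norm_sq_entangle]
  rw [Finset.sum_eq_single (0, 0)] <;> simp +contextual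

theorem preparedColumn_apply (q : Fin K → ℝ) (U : unitaryGroup (Fin k × Fin n) ℂ) (x) :
    preparedColumn q U x () =
      (entangle k n *ᵥ twistedPurification U 1) x.1 * (√(q x.2) : ℝ) := by
  obtain ⟨⟨x, b₁, b₂⟩, i⟩ := x
  have h : preparedColumn q U ((x, b₁, b₂), i) () =
      (liftOracle U *ᵥ fun y => initialColumn k n q (y, i) ()) (x, b₁, b₂) :=
    blockDiagonal_mulVec_apply (fun _ => liftOracle U) (fun y => initialColumn k n q y ()) _ _
  rw [h, liftOracle, blockDiagonal_mulVec_apply]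
  simp only [initialColumn, of_apply, entangle_mulVec_apply]
  split_ifs with h
  · simp only [mulVec, dotProduct, Pi.single_apply]
    rw [Finset.sum_eq_single (0, 0)]
    · simp [twistedPurification, purification]
      ring
    · intro y _ hy
      simp [hy]
    · simp
  · simp [mulVec, dotProduct]

theorem preparedColumn_isometry {q : Fin K → ℝ} (hq : ∀ i, 0 ≤ q i) (hq1 : ∑ i, q i = 1)
    (U : unitaryGroup (Fin k × Fin n) ℂ) : (preparedColumn q U)ᴴ * preparedColumn q U = 1 :=
  conjTranspose_mul_self_of_unitary_mul (liftOracleIndexed_mem_unitaryGroup U)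
    (conjTranspose_mul_self_unit _ (sum_norm_sq_initialColumn hq hq1))

theorem selectedWalk_mul_self (U : unitaryGroup (Fin k × Fin n) ℂ) :
    selectedWalk K U * selectedWalk K U = 1 := by
  rw [selectedWalk, ← blockDiagonal_mul]
  simp only [walk_palindrome_mul_self (reflectionMatrix_mul_self entangle_isometry)
    (purificationReflection_mul_self U)]
  exact blockDiagonal_one

/-- The selected walk is diagonal in the index register, so there are no cross terms and the
amplitudes enter only as `√(q i) * √(q i) = q i`. -/
theorem selectedWalk_expectation {q : Fin K → ℝ} (hq : ∀ i, 0 ≤ q i)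
    {U : unitaryGroup (Fin k × Fin n) ℂ} {ρ : Matrix (Fin n) (Fin n) ℂ}
    (h : IsPurifiedOracle U ρ) :
    (preparedColumn q U)ᴴ * (selectedWalk K U * preparedColumn q U) =
      Matrix.of fun _ _ => ∑ i, (q i : ℂ) * (ρ * Polynomial.aeval (1 - (2 / n : ℝ) • ρ)
        (Polynomial.Chebyshev.T ℝ ((i + 1 : ℕ) : ℤ))).trace := by
  ext
  simp only [of_apply, ← walk_expectation h]
  rw [mul_apply, Fintype.sum_prod_type, Finset.sum_comm]
  refine Finset.sum_congr rfl fun i _ => ?_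
  have hs : ((√(q i) : ℝ) : ℂ) * ((√(q i) : ℝ) : ℂ) = q i := by
    rw [← Complex.ofReal_mul, Real.mul_self_sqrt (hq i)]
  rw [dotProduct, Finset.mul_sum]
  refine Finset.sum_congr rfl fun y _ => ?_
  have hb : (selectedWalk K U * preparedColumn q U) (y, i) () =
      ((reflectionMatrix (entangle k n) * (purificationReflection U *
        reflectionMatrix (entangle k n)) ^ (i + 1 : ℕ)) *ᵥ
          fun y => preparedColumn q U (y, i) ()) y :=
    blockDiagonal_mulVec_apply _ (fun y => preparedColumn q U y ()) _ _
  have hp : (fun y => preparedColumn q U (y, i) ()) =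
      ((√(q i) : ℝ) : ℂ) • (entangle k n *ᵥ twistedPurification U 1) := by
    funext y
    rw [preparedColumn_apply, Pi.smul_apply, smul_eq_mul, mul_comm]
  rw [conjTranspose_apply, hb, hp, mulVec_smul, preparedColumn_apply, star_mul, ← hs]
  simp only [Pi.smul_apply, smul_eq_mul, Pi.star_apply, RCLike.star_def, Complex.conj_ofReal]
  ring

theorem alternatingCircuit_purificationReflection :
    AlternatingCircuit (liftOracle (k := k) (n := n)) 1 purificationReflection :=
  (AlternatingCircuit.conj (neg_mem_unitaryGroup (reflectionMatrix_mem_unitaryGroup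
    groundEmbedding_isometry)) swapMatrix_mem_unitaryGroup
      (Unitary.star_mem swapMatrix_mem_unitaryGroup)).congr purificationReflection_eq

theorem alternatingCircuit_selectedWalk :
    AlternatingCircuit (liftOracleIndexed (k := k) (n := n) K) K (selectedWalk K) := by
  have hR := reflectionMatrix_mem_unitaryGroup (entangle_isometry (k := k) (n := n))
  have hSR : AlternatingCircuit (liftOracle (k := k) (n := n)) 1 fun U =>
      purificationReflection U * reflectionMatrix (entangle k n) :=
    alternatingCircuit_purificationReflection.mul (.gate hR)
  refine AlternatingCircuit.select fun i => ?_
  refine AlternatingCircuit.gate_mul hR ((hSR.pow (i + 1)).mono liftOracle_mem_unitaryGroup ?_)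
  have := i.2
  omega

theorem alternatingCircuit_reflectionMatrix_preparedColumn {q : Fin K → ℝ} (hq : ∀ i, 0 ≤ q i)
    (hq1 : ∑ i, q i = 1) :
    AlternatingCircuit (liftOracleIndexed (k := k) (n := n) K) 1
      fun U => reflectionMatrix (preparedColumn q U) :=
  (AlternatingCircuit.conj (reflectionMatrix_mem_unitaryGroup (conjTranspose_mul_self_unit _
    (sum_norm_sq_initialColumn hq hq1))) (one_mem _) (one_mem _)).congr fun U => by
      rw [preparedColumn, reflectionMatrix_unitary_mul (liftOracleIndexed_mem_unitaryGroup U),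
        Matrix.one_mul, Matrix.mul_one]

/-- The splitting of the registers into the one that the oracle acts on and the workspace. -/
def registerEquiv (X W I T : Type*) : ((X × W) × I) × T ≃ X × ((W × I) × T) where
  toFun x := (x.1.1.1, ((x.1.1.2, x.1.2), x.2))
  invFun x := (((x.1, x.2.1.1), x.2.1.2), x.2.2)
  left_inv _ := rfl
  right_inv _ := rfl

/-- A query algorithm that estimates a linear combination of Chebyshev moments of `ρ`. -/
theorem exists_chebyshev_estimator (hN : 0 < N) (q : Fin K → ℝ) (hq : ∀ i, 0 ≤ q i)
    (hq1 : ∑ i, q i = 1) (f : ℝ → ℝ) :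
    ∃ 𝒜 : QueryAlgorithm k n, 𝒜.queries = 2 * (N * (K + 1)) + 1 ∧
      ∀ (ρ : Matrix (Fin n) (Fin n) ℂ) (U : unitaryGroup (Fin k × Fin n) ℂ),
        IsPurifiedOracle U ρ → ∀ a : ℝ, ∑ i, (q i : ℂ) *
          (ρ * Polynomial.aeval (1 - (2 / n : ℝ) • ρ)
            (Polynomial.Chebyshev.T ℝ ((i + 1 : ℕ) : ℤ))).trace = a →
        ∀ δ : ℝ, 0 < δ → ∀ S : Set ℝ, (∀ l, |l - a| ≤ δ → f l ∈ S) →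
          1 - 30 / (N * δ) ^ 2 ≤ 𝒜.outputProb U S := by
  have hK : 0 < K := by
    rcases Nat.eq_zero_or_pos K with rfl | h
    · simp at hq1
    · exact h
  have : Nonempty (Fin K) := ⟨⟨0, hK⟩⟩
  have : Nonempty (Fin N) := ⟨⟨0, hN⟩⟩
  set V := star ((pathMatrix_isHermitian N).eigenvectorUnitary : Matrix (Fin N) (Fin N) ℂ) with hV
  have hVu : (1 : Matrix (((Fin k × Fin n) × (Fin n × Fin n)) × Fin K)
      (((Fin k × Fin n) × (Fin n × Fin n)) × Fin K) ℂ) ⊗ₖ V ∈ unitaryGroup _ ℂ :=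
    kronecker_mem_unitary (one_mem _)
      (Unitary.star_mem (pathMatrix_isHermitian N).eigenvectorUnitary.2)
  set W : unitaryGroup (Fin k × Fin n) ℂ → Matrix (((Fin k × Fin n) × (Fin n × Fin n)) × Fin K)
      (((Fin k × Fin n) × (Fin n × Fin n)) × Fin K) ℂ :=
    fun U => selectedWalk K U * reflectionMatrix (preparedColumn q U) with hWdef
  have hW : AlternatingCircuit (liftOracleIndexed (k := k) (n := n) K) (K + 1) W :=
    alternatingCircuit_selectedWalk.mul (alternatingCircuit_reflectionMatrix_preparedColumn hq hq1)
  -- Clock value `t` runs the outer walk `t + 1 ≤ N` times; all branches are padded to `N * (K + 1)`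
  -- pairs of calls.
  have hF := AlternatingCircuit.gate_mul hVu (AlternatingCircuit.select fun t : Fin N =>
    (hW.pow (t + 1)).mono liftOracleIndexed_mem_unitaryGroup
      (Nat.mul_le_mul_right (K + 1) t.2))
  obtain ⟨𝒜, h𝒜, hprob⟩ := hF.exists_queryAlgorithm
    (registerEquiv (Fin k × Fin n) (Fin n × Fin n) (Fin K) (Fin N))
    (by
      intro U
      ext ⟨⟨⟨x, w⟩, i⟩, t⟩ ⟨⟨⟨x', w'⟩, i'⟩, t'⟩
      simp only [liftOracleIndexed, liftOracle, blockDiagonal_apply, submatrix_apply,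
        registerEquiv, Equiv.coe_fn_mk, kroneckerMap_apply, one_apply, Prod.mk.injEq]
      split_ifs <;> simp_all)
    (fun x => (clockAmplitude N (x.2 + 1) : ℂ) * initialColumn k n q x.1 ())
    (by
      rw [Fintype.sum_prod_type]
      simp only [norm_mul, mul_pow, Complex.norm_real, Real.norm_eq_abs, sq_abs]
      simp only [← Finset.sum_mul, sum_clockAmplitude_sq hN, one_mul]
      exact sum_norm_sq_initialColumn hq hq1)
    (fun x => f ((pathMatrix_isHermitian N).eigenvalues x.2))
  refine ⟨𝒜, h𝒜, fun ρ U hU a ha δ hδ S hS => ?_⟩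
  have hWu : W U ∈ unitaryGroup _ ℂ :=
    mul_mem (blockDiagonal_mem_unitaryGroup fun i => mul_mem
      (reflectionMatrix_mem_unitaryGroup entangle_isometry) (pow_mem (mul_mem
        (neg_mem_unitaryGroup (reflectionMatrix_mem_unitaryGroup
          (purificationEmbedding_isometry U)))
        (reflectionMatrix_mem_unitaryGroup entangle_isometry)) _))
      (reflectionMatrix_mem_unitaryGroup (preparedColumn_isometry hq hq1 U))
  set v : ℕ → ((Fin k × Fin n) × (Fin n × Fin n)) × Fin K → ℂ :=
    fun t y => (W U ^ t * preparedColumn q U) y () with hv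
  have hunit : ∀ t, ∑ y, ‖v t y‖ ^ 2 = 1 := by
    intro t
    refine (sum_norm_sq_mulVec_of_mem_unitaryGroup (pow_mem hWu t)
      fun y => preparedColumn q U y ()).trans ?_
    refine (sum_norm_sq_mulVec_of_mem_unitaryGroup (liftOracleIndexed_mem_unitaryGroup U)
      fun y => initialColumn k n q y ()).trans ?_
    exact sum_norm_sq_initialColumn hq hq1
  -- The range of `preparedColumn q U` is a line, so the compression in `walk_recurrence` is the `1
  -- × 1` matrix `a`.
  have hrec : ∀ t y, v (t + 2) y + v t y = 2 * a * v (t + 1) y := by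
    intro t y
    have h := congrFun (congrFun (walk_recurrence (selectedWalk_mul_self U)
      (preparedColumn_isometry hq hq1 U) t) y) ()
    rw [selectedWalk_expectation hq hU, ha, ← Matrix.mul_assoc] at h
    refine h.trans ?_
    rw [Matrix.smul_apply, mul_apply]
    simp [hv, hWdef]
    ring
  refine (phase_estimation hN v a hunit hrec hδ).trans ?_
  rw [hprob]
  have hstate : (((1 : Matrix (((Fin k × Fin n) × (Fin n × Fin n)) × Fin K)
      (((Fin k × Fin n) × (Fin n × Fin n)) × Fin K) ℂ) ⊗ₖ V *
        blockDiagonal fun t : Fin N => W U ^ (t + 1 : ℕ)) *ᵥ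
          ((blockDiagonal fun _ : Fin N => liftOracleIndexed K U) *ᵥ
            fun x => (clockAmplitude N (x.2 + 1) : ℂ) * initialColumn k n q x.1 ())) =
      ((1 : Matrix (((Fin k × Fin n) × (Fin n × Fin n)) × Fin K)
      (((Fin k × Fin n) × (Fin n × Fin n)) × Fin K) ℂ) ⊗ₖ V) *ᵥ
        fun x => (clockAmplitude N (x.2 + 1) : ℂ) * v (x.2 + 1) x.1 := by
    rw [← mulVec_mulVec]
    congr 1
    rw [mulVec_mulVec, ← blockDiagonal_mul]
    ext ⟨y, t⟩
    rw [blockDiagonal_mulVec_apply]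
    have : (fun y => (clockAmplitude N (t + 1) : ℂ) * initialColumn k n q y ()) =
      (clockAmplitude N (t + 1) : ℂ) • fun y => initialColumn k n q y () := rfl
    rw [this, mulVec_smul, Pi.smul_apply, smul_eq_mul]
    simp only [hv, preparedColumn, ← Matrix.mul_assoc]
    rfl
  rw [hstate]
  refine Finset.sum_le_sum fun x _ => ?_
  by_cases h : |(pathMatrix_isHermitian N).eigenvalues x.2 - a| ≤ δ
  · rw [if_pos h, if_pos (hS _ h)]
  · rw [if_neg h]
    split_ifs
    · positivity
    · exact le_rfl

end EntropyAlgorithm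

/-! ### Traces as sums over eigenvalues. -/

section Spectral

variable {n : ℕ}

theorem trace_cfc {A : Matrix (Fin n) (Fin n) ℂ} (hA : A.IsHermitian) (f : ℝ → ℝ) :
    (cfc f A).trace = ((∑ i, f (hA.eigenvalues i) : ℝ) : ℂ) := by
  rw [hA.cfc_eq, IsHermitian.cfc, Unitary.conjStarAlgAut_apply, trace_mul_cycle,
    mem_unitaryGroup_iff'.1 hA.eigenvectorUnitary.2, Matrix.one_mul, trace_diagonal]
  simp

/-- On a finite spectrum every function is continuous, so the functional calculus applies to
`Real.log` even when `0` is an eigenvalue. -/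
theorem trace_mul_cfc {A : Matrix (Fin n) (Fin n) ℂ} (hA : A.IsHermitian) (f : ℝ → ℝ) :
    (A * cfc f A).trace = ((∑ i, hA.eigenvalues i * f (hA.eigenvalues i) : ℝ) : ℂ) := by
  have hfin : (spectrum ℝ A).Finite := finite_real_spectrum
  have h : A * cfc f A = cfc (fun x => x * f x) A := by
    rw [cfc_mul (fun x => x) f A (hfin.continuousOn _) (hfin.continuousOn _),
      cfc_id' ℝ A hA.isSelfAdjoint]
  rw [h, trace_cfc hA]

theorem vonNeumannEntropy_eq_sum {ρ : Matrix (Fin n) (Fin n) ℂ} (hρ : ρ.IsHermitian) :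
    vonNeumannEntropy ρ = -∑ i, hρ.eigenvalues i * Real.log (hρ.eigenvalues i) := by
  rw [vonNeumannEntropy, trace_mul_cfc hρ, Complex.ofReal_re]

open Polynomial in
theorem trace_mul_aeval_affine {ρ : Matrix (Fin n) (Fin n) ℂ} (hρ : ρ.IsHermitian) (c : ℝ)
    (p : ℝ[X]) : (ρ * aeval (1 - c • ρ) p).trace =
      ((∑ i, hρ.eigenvalues i * p.eval (1 - c * hρ.eigenvalues i) : ℝ) : ℂ) := by
  have h : aeval (1 - c • ρ) p = cfc (p.comp (1 - C c * X)).eval ρ := by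
    rw [cfc_polynomial _ ρ hρ.isSelfAdjoint, aeval_comp]
    congr 2
    simp [Algebra.smul_def]
  rw [h, trace_mul_cfc hρ]
  simp

theorem IsDensityOperator.sum_eigenvalues {ρ : Matrix (Fin n) (Fin n) ℂ}
    (hρ : IsDensityOperator ρ) : ∑ i, hρ.1.isHermitian.eigenvalues i = 1 := by
  have h := hρ.1.isHermitian.trace_eq_sum_eigenvalues.symm.trans hρ.2
  rw [← Complex.ofReal_inj, Complex.ofReal_sum, Complex.ofReal_one]
  exact h

end Spectral

/-! ### Chebyshev approximation of the entropy. -/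

section Approximation

open Polynomial (Chebyshev.T)

/-- The Chebyshev expansion of the logarithm. -/
theorem hasSum_chebyshev_log {r x : ℝ} (hr₀ : 0 ≤ r) (hr₁ : r < 1) (hx : |x| ≤ 1) :
    HasSum (fun m : ℕ => r ^ m / m * (Chebyshev.T ℝ m).eval x)
      (-(Real.log (1 - 2 * r * x + r ^ 2) / 2)) := by
  obtain ⟨h₁, h₂⟩ := abs_le.1 hx
  set φ := Real.arccos x
  have hφ : Real.cos φ = x := Real.cos_arccos h₁ h₂
  -- With `x = cos φ`, the series is the real part of that of `-log (1 - z)`, and `‖1 - z‖ ^ 2 = 1 -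
  -- 2 r x + r ^ 2`. The term `m = 0` is harmless since `1 / 0 = 0`.
  set z : ℂ := r * Complex.exp (φ * Complex.I)
  have hz : ‖z‖ < 1 := by
    rw [norm_mul, Complex.norm_exp_ofReal_mul_I, mul_one, Complex.norm_real, Real.norm_eq_abs,
      abs_of_nonneg hr₀]
    exact hr₁
  have h := Complex.hasSum_re (Complex.hasSum_taylorSeries_neg_log hz)
  have hre : z.re = r * x := by
    rw [Complex.re_ofReal_mul, Complex.exp_ofReal_mul_I_re, hφ]
  have him : z.im = r * Real.sin φ := by
    rw [Complex.im_ofReal_mul, Complex.exp_ofReal_mul_I_im]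
  have hnorm : ‖1 - z‖ ^ 2 = 1 - 2 * r * x + r ^ 2 := by
    rw [← Complex.normSq_eq_norm_sq, Complex.normSq_apply, Complex.sub_re, Complex.sub_im, hre, him,
      Complex.one_re, Complex.one_im, ← hφ]
    linear_combination r ^ 2 * Real.sin_sq_add_cos_sq φ
  rw [Complex.neg_re, Complex.log_re] at h
  convert h using 1
  · funext m
    rw [← hφ, Polynomial.Chebyshev.T_real_cos, mul_pow, ← Complex.exp_nat_mul, ← mul_assoc,
      ← Complex.ofReal_pow, mul_div_right_comm, ← Complex.ofReal_natCast m, ← Complex.ofReal_div,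
      Complex.re_ofReal_mul, ← Complex.ofReal_mul, Complex.exp_ofReal_mul_I_re]
    simp
  · rw [← hnorm, Real.log_pow]
    push_cast
    ring

theorem abs_sum_chebyshev_add_log_le {r x : ℝ} (hr₀ : 0 ≤ r) (hr₁ : r < 1) (hx : |x| ≤ 1) (K : ℕ) :
    |2 * ∑ i : Fin K, r ^ (i + 1 : ℕ) / (i + 1 : ℕ) *
        (Chebyshev.T ℝ ((i + 1 : ℕ) : ℤ)).eval x + Real.log (1 - 2 * r * x + r ^ 2)| ≤
      2 * (r ^ (K + 1) / ((K + 1) * (1 - r))) := by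
  set f : ℕ → ℝ := fun m => r ^ m / m * (Chebyshev.T ℝ m).eval x with hf
  have hsum := hasSum_chebyshev_log hr₀ hr₁ hx
  have htail := (hasSum_nat_add_iff' (K + 1)).2 hsum
  have hb := norm_sub_le_of_geometric_bound_of_hasSum (C := r ^ (K + 1) / (K + 1)) hr₁
    (fun m => by
      have hT := Polynomial.Chebyshev.abs_eval_T_real_le_one ((m + (K + 1) : ℕ) : ℤ) hx
      rw [Real.norm_eq_abs, abs_mul, abs_of_nonneg (by positivity)]
      calc _ ≤ r ^ (m + (K + 1)) / (m + (K + 1) : ℕ) * 1 := by gcongr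
        _ ≤ r ^ (m + (K + 1)) / (K + 1) * 1 := by
          push_cast
          exact mul_le_mul_of_nonneg_right (div_le_div_of_nonneg_left (by positivity)
            (by positivity) (le_add_of_nonneg_left m.cast_nonneg)) zero_le_one
        _ = _ := by ring) htail 0
  rw [Finset.sum_range_zero, zero_sub, norm_neg, Real.norm_eq_abs, pow_zero, mul_one, div_div,
    Finset.sum_range_succ'] at hb
  rw [Fin.sum_univ_eq_sum_range (fun i => f (i + 1)) K]
  have h₀ : f 0 = 0 := by simp [hf]
  have e : 2 * ∑ i ∈ Finset.range K, f (i + 1) + Real.log (1 - 2 * r * x + r ^ 2) =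
      -2 * (-(Real.log (1 - 2 * r * x + r ^ 2) / 2) -
        (∑ i ∈ Finset.range K, f (i + 1) + f 0)) := by
    rw [h₀]
    ring
  rw [e, abs_mul]
  norm_num only [abs_neg, abs_two]
  gcongr

/-- This keeps the normalization of the coefficients logarithmic, so undoing it costs only a
logarithm in precision. -/
theorem sum_pow_div_le_neg_log {r : ℝ} (hr₀ : 0 ≤ r) (hr₁ : r < 1) (K : ℕ) :
    ∑ i : Fin K, r ^ (i + 1 : ℕ) / (i + 1 : ℕ) ≤ -Real.log (1 - r) := by
  rw [Fin.sum_univ_eq_sum_range (fun i => r ^ (i + 1) / ((i + 1 : ℕ) : ℝ)) K]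
  have h := Real.hasSum_pow_div_log_of_abs_lt_one (abs_lt.2 ⟨by linarith, hr₁⟩)
  push_cast
  exact sum_le_hasSum _ (fun i _ => by positivity) h

/-- From `log x ≤ x - 1` at `x = (p + η) / p`. The factor `p` makes the error uniform down to `p =
0`. -/
theorem mul_log_add_sub_le {p η : ℝ} (hp : 0 ≤ p) (hη : 0 ≤ η) :
    |p * (Real.log (p + η) - Real.log p)| ≤ η := by
  rcases hp.eq_or_lt with rfl | hp
  · simpa using hη
  · have h₁ : 0 ≤ Real.log (p + η) - Real.log p :=
      sub_nonneg.2 (Real.log_le_log hp (by linarith))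
    rw [abs_of_nonneg (by positivity), ← Real.log_div (by positivity) hp.ne']
    have h₂ := Real.log_le_sub_one_of_pos (x := (p + η) / p) (by positivity)
    calc _ ≤ p * ((p + η) / p - 1) := by gcongr
      _ = η := by field_simp; ring

/-- The entropy of a probability vector in terms of its Chebyshev moments. -/
theorem abs_chebyshev_sub_entropy_le {n : ℕ} (hn : 0 < n) (p : Fin n → ℝ) (hp : ∀ j, 0 ≤ p j)
    (hp1 : ∑ j, p j = 1) {r : ℝ} (hr₀ : 0 < r) (hr₁ : r < 1) (K : ℕ) :
    |2 * ∑ i : Fin K, r ^ (i + 1 : ℕ) / (i + 1 : ℕ) *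
        ∑ j, p j * (Chebyshev.T ℝ ((i + 1 : ℕ) : ℤ)).eval (1 - 2 / n * p j) +
        Real.log (4 * r / n) - -∑ j, p j * Real.log (p j)| ≤
      n * (n * (1 - r) ^ 2 / (4 * r)) + 2 * (r ^ (K + 1) / ((K + 1) * (1 - r))) := by
  have hn' : (0 : ℝ) < n := by exact_mod_cast hn
  have hn1 : (1 : ℝ) ≤ n := by exact_mod_cast hn
  have hs : 0 < 1 - r := by linarith
  set η := n * (1 - r) ^ 2 / (4 * r) with hη
  have hη₀ : 0 < η := by positivity
  set τ := 2 * (r ^ (K + 1) / ((K + 1) * (1 - r)))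
  set c : Fin K → ℝ := fun i => r ^ (i + 1 : ℕ) / (i + 1 : ℕ)
  set T : Fin K → Fin n → ℝ :=
    fun i j => (Chebyshev.T ℝ ((i + 1 : ℕ) : ℤ)).eval (1 - 2 / n * p j)
  set ℓ := Real.log (4 * r / n)
  have hterm : ∀ j, |p j * (2 * ∑ i, c i * T i j + ℓ + Real.log (p j))| ≤ η + p j * τ := by
    intro j
    have hpj1 : p j ≤ 1 := hp1 ▸ Finset.single_le_sum (fun i _ => hp i) (Finset.mem_univ j)
    have hx : |1 - 2 / n * p j| ≤ 1 := by
      have h₁ : 2 / n * p j ≤ 2 := by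
        rw [div_mul_eq_mul_div, div_le_iff₀ hn']
        nlinarith
      have h₂ : 0 ≤ 2 / n * p j := mul_nonneg (by positivity) (hp j)
      exact abs_le.2 ⟨by linarith, by linarith⟩
    have happ := abs_sum_chebyshev_add_log_le hr₀.le hr₁ hx K
    -- The argument equals `(1 - r)² + 4 r p_j / n = (4 r / n)(p_j + η)`, which dictates `η`.
    have hlog : Real.log (1 - 2 * r * (1 - 2 / n * p j) + r ^ 2) = ℓ + Real.log (p j + η) := by
      rw [← Real.log_mul (by positivity) (by have := hp j; positivity)]
      congr 1
      rw [hη]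
      field_simp
      ring
    rw [hlog] at happ
    have e : p j * (2 * ∑ i, c i * T i j + ℓ + Real.log (p j)) =
        p j * (2 * ∑ i, c i * T i j + (ℓ + Real.log (p j + η))) -
          p j * (Real.log (p j + η) - Real.log (p j)) := by ring
    rw [e]
    refine (abs_sub _ _).trans ?_
    have h₁ := mul_log_add_sub_le (hp j) hη₀.le
    have h₂ : |p j * (2 * ∑ i, c i * T i j + (ℓ + Real.log (p j + η)))| ≤ p j * τ := by
      rw [abs_mul, abs_of_nonneg (hp j)]
      exact mul_le_mul_of_nonneg_left happ (hp j)
    linarith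
  have e : 2 * ∑ i, c i * ∑ j, p j * T i j + ℓ - -∑ j, p j * Real.log (p j) =
      ∑ j, p j * (2 * ∑ i, c i * T i j + ℓ + Real.log (p j)) := by
    simp only [mul_add, Finset.sum_add_distrib, ← Finset.sum_mul, hp1, one_mul, Finset.mul_sum]
    rw [Finset.sum_comm, sub_neg_eq_add]
    congr 2
    refine Finset.sum_congr rfl fun j _ => Finset.sum_congr rfl fun i _ => ?_
    ring
  rw [e]
  calc _ ≤ ∑ j, (η + p j * τ) :=
        (Finset.abs_sum_le_sum_abs _ _).trans (Finset.sum_le_sum fun j _ => hterm j)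
    _ = n * η + τ := by
      rw [Finset.sum_add_distrib, ← Finset.sum_mul, hp1, one_mul, Finset.sum_const,
        Finset.card_univ, Fintype.card_fin, nsmul_eq_mul]

end Approximation

/-! ### Choice of parameters and the query count. -/

section Parameters

/-- The distance of the damping factor from `1`. -/
def dampingGap (n : ℕ) (ε : ℝ) : ℝ := √ε / (2 * n)

/-- The degree of the polynomial approximation. -/
def walkLength (n : ℕ) (ε : ℝ) : ℕ := ⌈(Real.log (8 / ε) + 1) / dampingGap n ε⌉₊

/-- The total weight of the coefficients of the polynomial approximation. -/
def totalWeight (n : ℕ) (ε : ℝ) : ℝ :=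
  ∑ i : Fin (walkLength n ε), (1 - dampingGap n ε) ^ (i + 1 : ℕ) / (i + 1 : ℕ)

/-- The dimension of the clock register. -/
def clockSize (n : ℕ) (ε : ℝ) : ℕ := ⌈40 * totalWeight n ε / ε⌉₊ + 1

variable {n : ℕ} {ε : ℝ}

theorem dampingGap_pos (hn : 0 < n) (hε : 0 < ε) : 0 < dampingGap n ε := by
  have : (0 : ℝ) < n := by exact_mod_cast hn
  rw [dampingGap]
  positivity

theorem dampingGap_le_half (hn : 0 < n) (hε : ε < 1) : dampingGap n ε ≤ 1 / 2 := by
  have h1 : (1 : ℝ) ≤ n := by exact_mod_cast hn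
  have h2 : √ε ≤ 1 := Real.sqrt_le_one.2 hε.le
  rw [dampingGap, div_le_div_iff₀ (by positivity) two_pos]
  linarith

theorem walkLength_pos (hn : 0 < n) (hε₀ : 0 < ε) (hε₁ : ε < 1) : 0 < walkLength n ε := by
  have h1 := dampingGap_pos hn hε₀
  have h2 : 0 < Real.log (8 / ε) := Real.log_pos (by rw [lt_div_iff₀ hε₀]; linarith)
  exact Nat.ceil_pos.2 (by positivity)

theorem truncation_error_le (hn : 0 < n) (hε₀ : 0 < ε) (hε₁ : ε < 1) :
    2 * ((1 - dampingGap n ε) ^ (walkLength n ε + 1) /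
      ((walkLength n ε + 1) * (1 - (1 - dampingGap n ε)))) ≤ ε / 4 := by
  have hs := dampingGap_pos hn hε₀
  have hs2 := dampingGap_le_half hn hε₁
  have hlog : 0 < Real.log (8 / ε) := Real.log_pos (by rw [lt_div_iff₀ hε₀]; linarith)
  have hK : Real.log (8 / ε) + 1 ≤ walkLength n ε * dampingGap n ε :=
    (div_le_iff₀ hs).1 (Nat.le_ceil _)
  set s := dampingGap n ε
  set K := walkLength n ε
  have hpow : (1 - s) ^ (K + 1) ≤ ε / 8 := by
    calc (1 - s) ^ (K + 1) ≤ (Real.exp (-s)) ^ (K + 1) := by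
          gcongr
          · linarith
          · exact Real.one_sub_le_exp_neg s
      _ = Real.exp (-((K + 1) * s)) := by rw [← Real.exp_nat_mul]; push_cast; ring_nf
      _ ≤ Real.exp (-Real.log (8 / ε)) := by
          gcongr
          linarith
      _ = ε / 8 := by rw [Real.exp_neg, Real.exp_log (by positivity), inv_div]
  -- The summand `1` in the definition of `walkLength` serves this bound; the logarithm serves
  -- `hpow`.
  have hden : 1 ≤ (K + 1) * (1 - (1 - s)) := by linarith
  have : (1 - s) ^ (K + 1) / ((K + 1) * (1 - (1 - s))) ≤ ε / 8 :=
    (div_le_self (pow_nonneg (by linarith) _) hden).trans hpow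
  linarith

theorem smoothing_error_le (hn : 0 < n) (hε₀ : 0 < ε) (hε₁ : ε < 1) :
    n * (n * (1 - (1 - dampingGap n ε)) ^ 2 / (4 * (1 - dampingGap n ε))) ≤ ε / 8 := by
  have hs2 := dampingGap_le_half hn hε₁
  have hn' : (0 : ℝ) < n := by exact_mod_cast hn
  -- The gap `√ε / (2n)` makes this product independent of `n`; the remaining `4(1 - dampingGap n
  -- ε)` is at least `2`.
  have h : n * (n * dampingGap n ε ^ 2) = ε / 4 := by
    rw [dampingGap, div_pow, Real.sq_sqrt hε₀.le]
    field_simp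
    ring
  rw [sub_sub_cancel, mul_div_assoc', h, div_le_iff₀ (by linarith)]
  nlinarith

theorem totalWeight_pos (hn : 0 < n) (hε₀ : 0 < ε) (hε₁ : ε < 1) : 0 < totalWeight n ε := by
  have hs2 := dampingGap_le_half hn hε₁
  have : Nonempty (Fin (walkLength n ε)) := ⟨⟨0, walkLength_pos hn hε₀ hε₁⟩⟩
  refine Finset.sum_pos (fun i _ => ?_) Finset.univ_nonempty
  have : 0 < 1 - dampingGap n ε := by linarith
  positivity

theorem queries_le (hn : 0 < n) (hε₀ : 0 < ε) (hε₁ : ε < 1) :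
    ((2 * (clockSize n ε * (walkLength n ε + 1)) + 1 : ℕ) : ℝ) ≤
      841 * ((n : ℝ) / ε ^ (3 / 2 : ℝ)) * (1 + Real.log ((n : ℝ) / ε ^ (3 / 2 : ℝ))) ^ 2 := by
  have hs := dampingGap_pos hn hε₀
  have hs2 := dampingGap_le_half hn hε₁
  have hL₀ := totalWeight_pos hn hε₀ hε₁
  have hn' : (0 : ℝ) < n := by exact_mod_cast hn
  have hn1 : (1 : ℝ) ≤ n := by exact_mod_cast hn
  have hq : 0 < √ε := Real.sqrt_pos.2 hε₀
  have hq1 : √ε ≤ 1 := Real.sqrt_le_one.2 hε₁.le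
  have hpow : ε ^ (3 / 2 : ℝ) = ε * √ε := by
    rw [show (3 / 2 : ℝ) = 1 + 1 / 2 by norm_num, Real.rpow_add hε₀, Real.rpow_one,
      ← Real.sqrt_eq_rpow]
  have hlogn : 0 ≤ Real.log n := Real.log_nonneg hn1
  have hlogε : Real.log ε < 0 := Real.log_neg hε₀ hε₁
  have hlog2 := Real.log_two_lt_d9
  have hlogz : Real.log (n / ε ^ (3 / 2 : ℝ)) = Real.log n - 3 / 2 * Real.log ε := by
    rw [Real.log_div hn'.ne' (by positivity), Real.log_rpow hε₀]
  set ℓ := 1 + Real.log (n / ε ^ (3 / 2 : ℝ)) with hℓ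
  have hℓ1 : 1 ≤ ℓ := by rw [hℓ, hlogz]; linarith
  have hL : totalWeight n ε ≤ ℓ := by
    refine (sum_pow_div_le_neg_log (by linarith) (by linarith) _).trans ?_
    rw [sub_sub_cancel, dampingGap, Real.log_div hq.ne' (by positivity),
      Real.log_mul two_ne_zero hn'.ne', Real.log_sqrt hε₀.le, hℓ, hlogz]
    linarith
  have hlog8 : Real.log (8 / ε) + 1 ≤ 4 * ℓ := by
    rw [Real.log_div (by norm_num) hε₀.ne', show (8 : ℝ) = 2 ^ 3 by norm_num, Real.log_pow, hℓ,
      hlogz]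
    push_cast
    linarith
  have hlogpos : 0 ≤ Real.log (8 / ε) := Real.log_nonneg (by rw [le_div_iff₀ hε₀]; linarith)
  have hK : (walkLength n ε + 1 : ℝ) ≤ 10 * ℓ * (n / √ε) := by
    have h₁ : (walkLength n ε : ℝ) ≤ (Real.log (8 / ε) + 1) / dampingGap n ε + 1 :=
      (Nat.ceil_lt_add_one (by positivity)).le
    have h₂ : (Real.log (8 / ε) + 1) / dampingGap n ε ≤ 8 * (ℓ * (n / √ε)) := by
      rw [dampingGap, div_div_eq_mul_div, div_le_iff₀ hq]
      calc _ ≤ 4 * ℓ * (2 * n) := by gcongr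
        _ = _ := by field_simp; ring
    have h₃ : 1 ≤ n / √ε := by rw [le_div_iff₀ hq]; linarith
    have h₄ : 1 ≤ ℓ * (n / √ε) := one_le_mul_of_one_le_of_one_le hℓ1 h₃
    linarith
  have hN : (clockSize n ε : ℝ) ≤ 42 * (ℓ / ε) := by
    have h₁ : ((⌈40 * totalWeight n ε / ε⌉₊ : ℕ) : ℝ) ≤ 40 * totalWeight n ε / ε + 1 :=
      (Nat.ceil_lt_add_one (by positivity)).le
    have h₂ : 40 * totalWeight n ε / ε ≤ 40 * (ℓ / ε) := by
      rw [mul_div_assoc]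
      gcongr
    have h₃ : 1 ≤ ℓ / ε := by rw [le_div_iff₀ hε₀]; linarith
    rw [clockSize]
    push_cast
    linarith
  have hz : 1 ≤ n / (ε * √ε) := by
    rw [le_div_iff₀ (by positivity)]
    nlinarith
  have hzℓ : 1 ≤ n / (ε * √ε) * ℓ ^ 2 := one_le_mul_of_one_le_of_one_le hz (one_le_pow₀ hℓ1)
  push_cast
  -- The constant is `841 = 2 * 42 * 10 + 1`, the last unit absorbing the single extra call.
  calc (2 * (clockSize n ε * (walkLength n ε + 1)) + 1 : ℝ)
      ≤ 2 * (42 * (ℓ / ε) * (10 * ℓ * (n / √ε))) + n / (ε * √ε) * ℓ ^ 2 := by gcongr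
    _ = 841 * (n / (ε * √ε)) * ℓ ^ 2 := by field_simp; ring
    _ = _ := by rw [hpow]

end Parameters
end

/-! ### Assembly of the error budget. -/

theorem mainTheorem2 :
    ∃ (C : ℝ) (c : ℕ), ∀ (n k : ℕ) [NeZero n] [NeZero k] (ε : ℝ), 0 < ε → ε < 1 →
      ∃ 𝒜 : QueryAlgorithm k n,
        (𝒜.queries : ℝ) ≤ C * ((n : ℝ) / ε ^ (3 / 2 : ℝ)) *
            (1 + Real.log ((n : ℝ) / ε ^ (3 / 2 : ℝ))) ^ c ∧
        ∀ (ρ : Matrix (Fin n) (Fin n) ℂ) (U : Matrix.unitaryGroup (Fin k × Fin n) ℂ),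
          IsDensityOperator ρ → IsPurifiedOracle U ρ →
            2 / 3 ≤ 𝒜.outputProb U {h : ℝ | |h - vonNeumannEntropy ρ| ≤ ε} := by
  refine ⟨841, 2, fun n k _ _ ε hε₀ hε₁ => ?_⟩
  have hn : 0 < n := Nat.pos_of_ne_zero (NeZero.ne n)
  have hs := dampingGap_pos hn hε₀
  have hs2 := dampingGap_le_half hn hε₁
  have hL := totalWeight_pos hn hε₀ hε₁
  set r := 1 - dampingGap n ε with hr
  set L := totalWeight n ε with hLdef
  have hr₀ : 0 < r := by linarith
  obtain ⟨𝒜, h𝒜, hprob⟩ := exists_chebyshev_estimator (k := k) (n := n) (N := clockSize n ε)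
    (Nat.succ_pos _) (fun i : Fin (walkLength n ε) => r ^ (i + 1 : ℕ) / (i + 1 : ℕ) / L)
    (fun i => by positivity) (by rw [← Finset.sum_div]; exact div_self hL.ne')
    -- Undoes the normalization by `L` and adds the constant from the expansion of the logarithm.
    (fun l => 2 * L * l + Real.log (4 * r / n))
  refine ⟨𝒜, by rw [h𝒜]; exact queries_le hn hε₀ hε₁, fun ρ U hρ hU => ?_⟩
  have hH := hρ.1.isHermitian
  set p := hH.eigenvalues
  set m : Fin (walkLength n ε) → ℝ := fun i =>
    ∑ j, p j * (Polynomial.Chebyshev.T ℝ ((i + 1 : ℕ) : ℤ)).eval (1 - 2 / n * p j)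
  set a : ℝ := ∑ i : Fin (walkLength n ε), r ^ (i + 1 : ℕ) / (i + 1 : ℕ) / L * m i with ha
  have hLa : L * a = ∑ i : Fin (walkLength n ε), r ^ (i + 1 : ℕ) / (i + 1 : ℕ) * m i := by
    rw [ha, Finset.mul_sum]
    refine Finset.sum_congr rfl fun i _ => ?_
    field_simp
  have happ := abs_chebyshev_sub_entropy_le hn p hρ.1.eigenvalues_nonneg hρ.sum_eigenvalues hr₀
    (by linarith) (walkLength n ε)
  rw [← vonNeumannEntropy_eq_sum hH, ← hLa] at happ
  have h₁ := truncation_error_le hn hε₀ hε₁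
  have h₂ := smoothing_error_le hn hε₀ hε₁
  rw [← hr] at h₁ h₂
  refine le_trans ?_ (hprob ρ U hU a ?_ (ε / (4 * L)) (by positivity) _ fun l hl => ?_)
  · have hN : 40 * L / ε ≤ clockSize n ε := by
      rw [clockSize]
      push_cast
      exact (Nat.le_ceil _).trans (le_add_of_nonneg_right zero_le_one)
    -- The `40` in `clockSize` makes `N δ ≥ 10` for `δ = ε / (4 L)`, so the failure probability is
    -- at most `30 / 100 < 1 / 3`.
    have h10 : 10 ≤ clockSize n ε * (ε / (4 * L)) := by
      calc (10 : ℝ) = 40 * L / ε * (ε / (4 * L)) := by field_simp; norm_num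
        _ ≤ _ := by gcongr
    have : 30 / (clockSize n ε * (ε / (4 * L))) ^ 2 ≤ (30 : ℝ) / 10 ^ 2 := by gcongr
    linarith
  · rw [ha, Complex.ofReal_sum]
    refine Finset.sum_congr rfl fun i _ => ?_
    rw [trace_mul_aeval_affine hH, Complex.ofReal_mul]
  · have hl' : |2 * L * (l - a)| ≤ ε / 2 := by
      rw [abs_mul, abs_of_pos (by positivity)]
      calc 2 * L * |l - a| ≤ 2 * L * (ε / (4 * L)) := by gcongr
        _ = ε / 2 := by field_simp; norm_num
    have e : 2 * L * l + Real.log (4 * r / n) - vonNeumannEntropy ρ =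
        2 * L * (l - a) + (2 * (L * a) + Real.log (4 * r / n) - vonNeumannEntropy ρ) := by ring
    rw [Set.mem_ofPred_eq, e]
    refine (abs_add_le _ _).trans ?_
    -- Phase estimation contributes `ε / 2`, truncation `ε / 4` and smoothing `ε / 8`.
    linarith
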